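/- Let $w$ be a strictly positive analytic weight on the unit circle $\mathbb T_1=\{|z|=1\}$, i.e. $w:\mathbb T_1\to(0,\infty)$ is the restriction of a function holomorphic in a neighbourhood of $\mathbb T_1$. Let $\Phi_n$, $n\ge 0$, be the monic orthogonal polynomials of the measure $w(z)\,|dz|$ ($\deg\Phi_n=n$, $\oint_{\mathbb T_1}\Phi_n\overline{\Phi_m}\,w\,|dz|=0$ for $m\ne n$), and let $\alpha_n=-\overline{\Phi_{n+1}(0)}$, $n\ge 0$, be the Verblunsky coefficients. Let $$\rho=\inf\{0<r<1:\ 1/w \text{ extends holomorphically to } r<|z|<1/r\}.$$ Let $D_{\rm i}$ and $D_{\rm e}$ be the restrictions to $|z|<1$ and $|z|>1$, respectively, of the Szegő function $$D(w;z)=\exp\left(\frac1{4\pi}\int_0^{2\pi}\log w(e^{i\theta})\,\frac{e^{i\theta}+z}{e^{i\theta}-z}\,d\theta\right),\qquad |z|\ne 1 .$$ Both have non-zero analytic continuations across $\mathbb T_1$. Put $\mathcal S=D_{\rm i}D_{\rm e}$ near $\mathbb T_1$, and let $(1/\mathcal S)_k=\frac1{2\pi i}\oint_{\mathbb T_1}\frac{z^{-k-1}}{\mathcal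 S(z)}\,dz$, $k\in\mathbb Z$, be the Laurent coefficients of $1/\mathcal S$ in an annulus containing $\mathbb T_1$. More precisely: if $0\le s<1$ and $w$ extends to a zero-free holomorphic function in the annulus $s<|z|<1/s$ (with $1/0=\infty$), then $D_{\rm i}$ and $D_{\rm e}$ extend holomorphically to $|z|<1/s$ and $|z|>s$, respectively, their values on $\mathbb T_1$ are their boundary values, $D_{\rm i}D_{\rm e}$ has no zeros in $s<|z|<1/s$, and there $$\frac1{\mathcal S(z)}=\sum_{k\in\mathbb Z}\left(\frac1{\mathcal S}\right)_k z^k .$$ Moreover, for every $r$ with $\rho<r<1$, $$\alpha_n=-\left(\frac1{\mathcal S}\right)_{n+1}+\mathcal O(r^{3n}),$$ that is, there is a constant $K$, depending only on $w$ and $r$, such that $\left|\alpha_n+(1/\mathcal S)_{n+1}\right|\le K r^{3n}$ for all $n\ge 0$. -/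

import Mathlib

open Complex Metric Set Polynomial
open scoped Real ComplexConjugate

noncomputable section

/-- The annulus `s < |z| < 1/s` for `0 < s < 1` (and `ℂ ∖ {0}` for `s = 0`). -/
def annulus (s : ℝ) : Set ℂ := {z | s < ‖z‖ ∧ s * ‖z‖ < 1}

/-- A weight on the unit circle is analytic if it is the restriction of a function that is
holomorphic in a neighbourhood of the unit circle. -/
def IsAnalyticWeight (w : Circle → ℝ) : Prop :=
  ∃ W : ℂ → ℂ, AnalyticOnNhd ℂ W (sphere 0 1) ∧ ∀ z : Circle, W z = w z

/-- `ρ = inf {0 < r < 1 : 1/w is holomorphic in r < |z| < 1/r}`. -/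
def criticalRadius (w : Circle → ℝ) : ℝ :=
  sInf {r : ℝ | 0 < r ∧ r < 1 ∧
    ∃ V : ℂ → ℂ, DifferentiableOn ℂ V (annulus r) ∧ ∀ z : Circle, V z = 1 / (w z : ℂ)}

/-! ### Orthogonal polynomials and Verblunsky coefficients -/

/-- `⟨P, Q⟩ = ∮ P(z) conj(Q(z)) w(z) |dz|` over the unit circle. -/
def weightInner (w : Circle → ℝ) (P Q : ℂ[X]) : ℂ :=
  ∫ θ in (0 : ℝ)..2 * π,
    P.eval (Circle.exp θ : ℂ) * conj (Q.eval (Circle.exp θ : ℂ)) * (w (Circle.exp θ) : ℂ)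

/-- The monic orthogonal polynomials `Φ₀, Φ₁, …` of the measure `w |dz|`, obtained from
`1, z, z², …` by the Gram–Schmidt process without normalization. -/
def monicOPUC (w : Circle → ℝ) : ℕ → ℂ[X]
  | n => X ^ n - ∑ k : Fin n,
      C (weightInner w (X ^ n) (monicOPUC w k) /
        weightInner w (monicOPUC w k) (monicOPUC w k)) * monicOPUC w k
  termination_by n => n
  decreasing_by exact k.isLt

/-- The Verblunsky coefficients `α_n = - conj (Φ_{n+1}(0))`. -/
def verblunsky (w : Circle → ℝ) (n : ℕ) : ℂ := -conj ((monicOPUC w (n + 1)).eval 0)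

theorem monicOPUC_eq (w : Circle → ℝ) (n : ℕ) :
    monicOPUC w n = X ^ n - ∑ k : Fin n,
      C (weightInner w (X ^ n) (monicOPUC w k) /
        weightInner w (monicOPUC w k) (monicOPUC w k)) * monicOPUC w k := by
  rw [monicOPUC]

theorem monicOPUC_monic_natDegree (w : Circle → ℝ) (n : ℕ) :
    (monicOPUC w n).Monic ∧ (monicOPUC w n).natDegree = n := by
  induction n using Nat.strong_induction_on with
  | _ n ih =>
    have hlt : (∑ k : Fin n,
        C (weightInner w (X ^ n) (monicOPUC w k) /
          weightInner w (monicOPUC w k) (monicOPUC w k)) * monicOPUC w k).degree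
          < (X ^ n : ℂ[X]).degree := by
      rw [degree_X_pow]
      refine (degree_sum_le _ _).trans_lt ?_
      refine (Finset.sup_lt_iff (WithBot.bot_lt_coe n)).mpr ?_
      intro k _
      rw [← smul_eq_C_mul]
      refine (degree_smul_le _ _).trans_lt ?_
      rw [degree_eq_natDegree (ih k k.isLt).1.ne_zero, (ih k k.isLt).2]
      exact WithBot.coe_lt_coe.mpr k.isLt
    rw [monicOPUC_eq]
    refine ⟨(monic_X_pow n).sub_of_left hlt, ?_⟩
    rw [natDegree_eq_of_degree_eq (degree_sub_eq_left_of_degree_lt hlt), natDegree_X_pow]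

theorem weightInner_integrand_continuous {w : Circle → ℝ} (hw : Continuous w) (P Q : ℂ[X]) :
    Continuous fun θ : ℝ =>
      P.eval (Circle.exp θ : ℂ) * conj (Q.eval (Circle.exp θ : ℂ)) * (w (Circle.exp θ) : ℂ) := by
  fun_prop

theorem weightInner_self_ne_zero {w : Circle → ℝ} (hw : Continuous w) (hpos : ∀ z, 0 < w z)
    {P : ℂ[X]} (hP : P ≠ 0) : weightInner w P P ≠ 0 := by
  have h : weightInner w P P =
      ((∫ θ in (0 : ℝ)..2 * π, ‖P.eval (Circle.exp θ : ℂ)‖ ^ 2 * w (Circle.exp θ) : ℝ) : ℂ) := by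
    rw [weightInner, ← intervalIntegral.integral_ofReal]
    congr 1
    ext θ
    rw [Complex.mul_conj, Complex.normSq_eq_norm_sq]
    push_cast
    rfl
  rw [h, Complex.ofReal_ne_zero]
  refine (intervalIntegral.integral_pos Real.two_pi_pos (by fun_prop)
    (fun θ _ => mul_nonneg (sq_nonneg _) (hpos _).le) ?_).ne'
  by_contra! hcon
  apply hP
  refine Polynomial.eq_zero_of_infinite_isRoot P (Set.Infinite.mono
    (s := (fun θ : ℝ => (Circle.exp θ : ℂ)) '' Ico 0 (2 * π)) ?_ ?_)
  · rintro _ ⟨θ, hθ, rfl⟩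
    have h1 := hcon θ ⟨hθ.1, hθ.2.le⟩
    by_contra h2
    exact absurd h1 (not_le.mpr (mul_pos (pow_pos (norm_pos_iff.mpr h2) 2) (hpos _)))
  · refine (Ico_infinite Real.two_pi_pos).image ?_
    intro a ha b hb hab
    exact Circle.exp_injOn_Ico (by simp) ha hb (Circle.ext hab)

theorem weightInner_conj (w : Circle → ℝ) (P Q : ℂ[X]) :
    weightInner w Q P = conj (weightInner w P Q) := by
  rw [weightInner, weightInner, ← intervalIntegral.intervalIntegral_conj]
  congr 1
  ext θ
  simp only [map_mul, Complex.conj_conj, Complex.conj_ofReal]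
  ring

/-- Different members of the sequence are orthogonal with respect to `w |dz|`. -/
theorem monicOPUC_orthogonal {w : Circle → ℝ} (hw : Continuous w) (hpos : ∀ z, 0 < w z)
    {m n : ℕ} (hmn : m ≠ n) : weightInner w (monicOPUC w n) (monicOPUC w m) = 0 := by
  have key : ∀ n, ∀ m < n, weightInner w (monicOPUC w n) (monicOPUC w m) = 0 := by
    intro n
    induction n using Nat.strong_induction_on with
    | _ n ih =>
      intro m hm
      have hint : ∀ P Q : ℂ[X], IntervalIntegrable (fun θ : ℝ =>
          P.eval (Circle.exp θ : ℂ) * conj (Q.eval (Circle.exp θ : ℂ)) *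
            (w (Circle.exp θ) : ℂ)) MeasureTheory.volume 0 (2 * π) := fun P Q =>
        (weightInner_integrand_continuous hw P Q).intervalIntegrable _ _
      let L : ℂ[X] →ₗ[ℂ] ℂ :=
        { toFun := fun P => weightInner w P (monicOPUC w m)
          map_add' := fun P Q => by
            simp only [weightInner]
            rw [← intervalIntegral.integral_add (hint _ _) (hint _ _)]
            congr 1
            ext θ
            simp only [eval_add]
            ring
          map_smul' := fun c P => by
            simp only [weightInner, RingHom.id_apply, smul_eq_mul]
            rw [← intervalIntegral.integral_const_mul]
            congr 1
            ext θ
            simp only [eval_smul, smul_eq_mul]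
            ring }
      have hL : ∀ P, weightInner w P (monicOPUC w m) = L P := fun _ => rfl
      rw [monicOPUC_eq w n, hL, map_sub, map_sum]
      simp only [← smul_eq_C_mul, map_smul, smul_eq_mul]
      rw [Finset.sum_eq_single (⟨m, hm⟩ : Fin n)]
      · rw [← hL, ← hL, div_mul_cancel₀, sub_self]
        exact weightInner_self_ne_zero hw hpos (monicOPUC_monic_natDegree w m).1.ne_zero
      · intro k _ hk
        have hkm : (k : ℕ) ≠ m := fun h => hk (Fin.ext h)
        rw [← hL]
        rcases lt_or_gt_of_ne hkm with h | h
        · rw [weightInner_conj w (monicOPUC w m) (monicOPUC w k), ih m hm k h, map_zero, mul_zero]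
        · rw [ih k k.isLt m h, mul_zero]
      · simp
  rcases lt_or_gt_of_ne hmn with h | h
  · exact key n m h
  · rw [weightInner_conj, key m n h, map_zero]

/-! ### Szegő function, scattering function, Laurent coefficients -/

/-- The Szegő function
`D(w; z) = exp ((1/4π) ∫₀^{2π} log w(e^{iθ}) (e^{iθ} + z)/(e^{iθ} - z) dθ)`, `|z| ≠ 1`. -/
def szegoD (w : Circle → ℝ) (z : ℂ) : ℂ :=
  exp (1 / (4 * π) * ∫ θ in (0 : ℝ)..2 * π,
    (Real.log (w (Circle.exp θ)) : ℂ) *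
      (((Circle.exp θ : ℂ) + z) / ((Circle.exp θ : ℂ) - z)))

/-- The interior Szegő function `D_i`, extended to `|z| = 1` by its boundary values. -/
def szegoInt (w : Circle → ℝ) : ℂ → ℂ := extendFrom {z | ‖z‖ < 1} (szegoD w)

/-- The exterior Szegő function `D_e`, extended to `|z| = 1` by its boundary values. -/
def szegoExt (w : Circle → ℝ) : ℂ → ℂ := extendFrom {z | 1 < ‖z‖} (szegoD w)

/-- The scattering function `𝒮 = D_i D_e` on the unit circle. -/
def scattering (w : Circle → ℝ) (z : ℂ) : ℂ := szegoInt w z * szegoExt w z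

/-- The `k`-th Laurent coefficient `(1/2πi) ∮ f(z) z^{-k-1} dz` over `|z| = 1` of a function
that is holomorphic in an annulus containing the unit circle. -/
def laurentCoeff (f : ℂ → ℂ) (k : ℤ) : ℂ :=
  (2 * π * I)⁻¹ * ∮ z in C(0, 1), f z * z ^ (-k - 1)

end

/-! ### Laurent coefficients of functions on the unit circle -/

/-! Everything is done with Laurent coefficients on the unit circle. On the circle `w = D_i / D_e`,
where `D_i = exp h₊(z)` and `D_e = exp (-h₋(1/z))` come from splitting the Laurent series of `log w`
(`exists_log_szegoD`). Since these are exponentials, `D_i` and `1/D_i` have only nonnegative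
frequencies, and `D_e` and `1/D_e` only nonpositive ones.

Put `N = n + 1` and let `Y = z^N conj Φ_N` on the circle be the reversed polynomial. Its frequencies
lie in `[0, N]`, its coefficient at `0` is `1`, and its coefficient at `N` is `conj Φ_N(0) = -α_n`.
Orthogonality says that `Y w` has no frequencies in `[1, N]`, so `Y w = A + z^(N+1) B` with `A`
supported in `k ≤ 0` and `B` in `k ≥ 0`. With `q = D_e A` and `p = B / D_i`, multiplying by `D_e`
and dividing by `D_i` respectively gives `D_i Y = q + z^(N+1) 𝒮 p` and `Y / D_e = q / 𝒮 + z^(N+1)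
p`. The first left side has no negative frequencies, the second none above `N`.

The coefficients `(1/𝒮)_k` and `𝒮_{-k}`, `k ≥ 0`, are `O(r^k)`: `1/𝒮 = (1/w) / D_e²` extends
outwards as far as `1/w` does, and `|𝒮| = 1` on the circle. The second equation then gives `p =
O(r^N)`. Inserted in the first, this makes the negative coefficients of `q`, and the deviation of
`q_0` from `(D_i Y)_0`, of size `O(r^(2N))`. Back in the second equation at frequency `N`, the right
side is `(D_i Y)_0 (1/𝒮)_N + O(r^(3N))`. The normalizing factors `D_i(0)` and `(1/D_e)_0` agree and
cancel. The bootstrap is `norm_sub_le_of_coupled`, the reduction to it is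
`norm_top_laurentCoeff_sub_le`, and the bound on `q` uniform in `n` comes from
`integral_norm_monicOPUC_mul_le`. -/

theorem circleMap_zero_one_mem (θ : ℝ) : circleMap 0 1 θ ∈ sphere (0 : ℂ) 1 :=
  circleMap_mem_sphere 0 zero_le_one θ

theorem ne_zero_of_mem_unitSphere {z : ℂ} (hz : z ∈ sphere (0 : ℂ) 1) : z ≠ 0 :=
  ne_zero_of_mem_unit_sphere (⟨z, hz⟩ : sphere (0 : ℂ) 1)

theorem norm_zpow_of_mem_unitSphere {z : ℂ} (hz : z ∈ sphere (0 : ℂ) 1) (k : ℤ) :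
    ‖z ^ k‖ = 1 := by
  rw [norm_zpow, mem_sphere_zero_iff_norm.mp hz, one_zpow]

theorem continuousOn_zpow_unitSphere (k : ℤ) :
    ContinuousOn (fun z : ℂ => z ^ k) (sphere (0 : ℂ) 1) :=
  continuousOn_id.zpow₀ k fun _ hz => Or.inl (ne_zero_of_mem_unitSphere hz)

theorem continuous_comp_circleMap {f : ℂ → ℂ} (hf : ContinuousOn f (sphere 0 1)) :
    Continuous fun θ : ℝ => f (circleMap 0 1 θ) :=
  hf.comp_continuous (continuous_circleMap 0 1) circleMap_zero_one_mem

theorem laurentCoeff_eq_intervalIntegral (f : ℂ → ℂ) (k : ℤ) :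
    laurentCoeff f k = (2 * π : ℂ)⁻¹ *
      ∫ θ in (0 : ℝ)..2 * π, f (circleMap 0 1 θ) * circleMap 0 1 θ ^ (-k) := by
  have h : (∮ z in C(0, 1), f z * z ^ (-k - 1)) =
      I * ∫ θ in (0 : ℝ)..2 * π, f (circleMap 0 1 θ) * circleMap 0 1 θ ^ (-k) := by
    rw [circleIntegral, ← intervalIntegral.integral_const_mul]
    congr 1
    ext θ
    have h0 := ne_zero_of_mem_unitSphere (circleMap_zero_one_mem θ)
    rw [deriv_circleMap, zpow_sub_one₀ h0, smul_eq_mul]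
    field_simp
  rw [laurentCoeff, h, mul_inv, ← mul_assoc, mul_assoc _ I⁻¹, inv_mul_cancel₀ I_ne_zero, mul_one]

theorem laurentCoeff_congr {f g : ℂ → ℂ} (h : EqOn f g (sphere 0 1)) (k : ℤ) :
    laurentCoeff f k = laurentCoeff g k := by
  rw [laurentCoeff, laurentCoeff]
  congr 1
  exact circleIntegral.integral_congr zero_le_one fun z hz => by simp only [h hz]

theorem laurentCoeff_add {f g : ℂ → ℂ} (hf : ContinuousOn f (sphere 0 1))
    (hg : ContinuousOn g (sphere 0 1)) (k : ℤ) :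
    laurentCoeff (fun z => f z + g z) k = laurentCoeff f k + laurentCoeff g k := by
  have hz := continuousOn_zpow_unitSphere (-k - 1)
  rw [laurentCoeff, laurentCoeff, laurentCoeff, ← mul_add, ← circleIntegral.integral_add
    ((hf.fun_mul hz).circleIntegrable zero_le_one)
    ((hg.fun_mul hz).circleIntegrable zero_le_one)]
  simp only [add_mul]

theorem laurentCoeff_const_mul (c : ℂ) (f : ℂ → ℂ) (k : ℤ) :
    laurentCoeff (fun z => c * f z) k = c * laurentCoeff f k := by
  simp only [laurentCoeff, mul_assoc c, circleIntegral.integral_const_mul]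
  ring

theorem laurentCoeff_sub {f g : ℂ → ℂ} (hf : ContinuousOn f (sphere 0 1))
    (hg : ContinuousOn g (sphere 0 1)) (k : ℤ) :
    laurentCoeff (fun z => f z - g z) k = laurentCoeff f k - laurentCoeff g k := by
  have h := laurentCoeff_add hf ((continuousOn_const (c := (-1 : ℂ))).fun_mul hg) k
  rw [laurentCoeff_const_mul] at h
  simpa [sub_eq_add_neg] using h

theorem laurentCoeff_zpow_mul (m : ℤ) (f : ℂ → ℂ) (k : ℤ) :
    laurentCoeff (fun z => z ^ m * f z) k = laurentCoeff f (k - m) := by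
  rw [laurentCoeff, laurentCoeff]
  congr 1
  refine circleIntegral.integral_congr zero_le_one fun z hz => ?_
  have h0 := ne_zero_of_mem_unitSphere hz
  change z ^ m * f z * z ^ (-k - 1) = f z * z ^ (-(k - m) - 1)
  rw [show -(k - m) - 1 = m + (-k - 1) by ring, zpow_add₀ h0]
  ring

theorem laurentCoeff_zpow (m k : ℤ) :
    laurentCoeff (fun z => z ^ m) k = if k = m then 1 else 0 := by
  have h := laurentCoeff_zpow_mul m (fun _ => 1) k
  simp only [mul_one] at h
  rw [h, laurentCoeff]
  simp only [one_mul]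
  split_ifs with hk
  · subst hk
    have h1 := circleIntegral.integral_sub_center_inv (0 : ℂ) one_ne_zero
    simp only [sub_zero] at h1
    simp only [sub_self, neg_zero, zero_sub, zpow_neg_one, h1]
    exact inv_mul_cancel₀ Complex.two_pi_I_ne_zero
  · have h1 := circleIntegral.integral_sub_zpow_of_ne (n := -(k - m) - 1) (by omega) 0 0 1
    simp only [sub_zero] at h1
    rw [h1, mul_zero]

theorem circleMap_zero_one_conj (θ : ℝ) : conj (circleMap 0 1 θ) = (circleMap 0 1 θ)⁻¹ := by
  rw [← Complex.inv_eq_conj (mem_sphere_zero_iff_norm.mp (circleMap_zero_one_mem θ))]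

theorem laurentCoeff_conj (f : ℂ → ℂ) (k : ℤ) :
    laurentCoeff (fun z => conj (f z)) k = conj (laurentCoeff f (-k)) := by
  rw [laurentCoeff_eq_intervalIntegral, laurentCoeff_eq_intervalIntegral, map_mul,
    ← intervalIntegral.intervalIntegral_conj]
  simp [circleMap_zero_one_conj, Complex.conj_ofNat]

theorem laurentCoeff_comp_inv (f : ℂ → ℂ) (k : ℤ) :
    laurentCoeff (fun z => f z⁻¹) k = laurentCoeff f (-k) := by
  rw [laurentCoeff_eq_intervalIntegral, laurentCoeff_eq_intervalIntegral]
  have h := intervalIntegral.integral_comp_sub_left (a := 0) (b := 2 * π)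
    (fun θ : ℝ => f (circleMap 0 1 θ) * circleMap 0 1 θ ^ (- -k)) (2 * π)
  rw [sub_self, sub_zero] at h
  rw [← h]
  congr 2
  ext θ
  have h1 : circleMap 0 1 (2 * π - θ) = (circleMap 0 1 θ)⁻¹ := by
    simp only [circleMap, zero_add, ofReal_one, one_mul, ← Complex.exp_neg]
    push_cast
    rw [show (2 * π - θ : ℂ) * I = -(θ * I) + 2 * π * I by ring, Complex.exp_periodic]
  simp only [h1, inv_zpow', neg_neg]

/-- Termwise computation of Laurent coefficients of a uniformly convergent series. -/
theorem hasSum_laurentCoeff {ι : Type*} [Countable ι] {F : ι → ℂ → ℂ} {f : ℂ → ℂ} {u : ι → ℝ}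
    (hu : Summable u) (hF : ∀ i, ContinuousOn (F i) (sphere 0 1))
    (hb : ∀ i, ∀ z ∈ sphere (0 : ℂ) 1, ‖F i z‖ ≤ u i)
    (hs : ∀ z ∈ sphere (0 : ℂ) 1, HasSum (fun i => F i z) (f z)) (k : ℤ) :
    HasSum (fun i => laurentCoeff (F i) k) (laurentCoeff f k) := by
  simp only [laurentCoeff_eq_intervalIntegral]
  refine HasSum.mul_left _ ?_
  have hz := continuousOn_zpow_unitSphere (-k)
  refine intervalIntegral.hasSum_integral_of_dominated_convergence (fun i _ => u i) ?_ ?_ ?_ ?_ ?_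
  · exact fun i => (continuous_comp_circleMap ((hF i).mul hz)).aestronglyMeasurable
  · refine fun i => Filter.Eventually.of_forall fun θ _ => ?_
    rw [norm_mul, norm_zpow_of_mem_unitSphere (circleMap_zero_one_mem θ), mul_one]
    exact hb i _ (circleMap_zero_one_mem θ)
  · exact Filter.Eventually.of_forall fun _ _ => hu
  · exact intervalIntegrable_const
  · exact Filter.Eventually.of_forall fun θ _ =>
      (hs _ (circleMap_zero_one_mem θ)).mul_right _

/-- These are Fourier coefficients on `AddCircle (2 * π)`, so absolute summability gives pointwise
convergence. -/
theorem hasSum_laurentCoeff_mul_zpow {f : ℂ → ℂ} (hf : ContinuousOn f (sphere 0 1))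
    (hs : Summable (laurentCoeff f)) {z : ℂ} (hz : z ∈ sphere (0 : ℂ) 1) :
    HasSum (fun k : ℤ => laurentCoeff f k * z ^ k) (f z) := by
  have : Fact (0 < 2 * π) := ⟨Real.two_pi_pos⟩
  let F : C(AddCircle (2 * π), ℂ) := ⟨fun x => f (AddCircle.toCircle x : ℂ),
    hf.comp_continuous (by fun_prop) fun x => by
      rw [mem_sphere_zero_iff_norm, Circle.norm_coe]⟩
  have hF : ∀ θ : ℝ, F (θ : AddCircle (2 * π)) = f (circleMap 0 1 θ) := fun θ => by
    change f _ = f _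
    rw [AddCircle.toCircle_apply_mk]
    simp [circleMap, Real.pi_ne_zero]
  have hfour : ∀ (n : ℤ) (θ : ℝ), fourier n (θ : AddCircle (2 * π)) = circleMap 0 1 θ ^ n := by
    intro n θ
    rw [fourier_coe_apply, circleMap]
    simp only [ofReal_one, one_mul, zero_add, ← Complex.exp_int_mul]
    congr 1
    have : (π : ℂ) ≠ 0 := by exact_mod_cast Real.pi_ne_zero
    push_cast
    field_simp
  have hcoef : fourierCoeff F = laurentCoeff f := by
    ext n
    rw [fourierCoeff_eq_intervalIntegral _ _ 0, laurentCoeff_eq_intervalIntegral]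
    simp only [hF, hfour, smul_eq_mul, zero_add, Complex.real_smul]
    push_cast
    rw [one_div]
    simp only [mul_comm]
  obtain ⟨θ, rfl⟩ : z ∈ range (circleMap 0 1) := by
    rw [range_circleMap, abs_one]
    exact hz
  have h := has_pointwise_sum_fourier_series_of_summable (f := F) (by rwa [hcoef])
    (θ : AddCircle (2 * π))
  simpa only [hcoef, hF, hfour, smul_eq_mul] using h

/-- Only the first factor is expanded; the second need only be continuous. This lets the truncated
functions `A` and `B` below serve as second factors. -/
theorem hasSum_laurentCoeff_mul {f g : ℂ → ℂ} (hf : ContinuousOn f (sphere 0 1))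
    (hg : ContinuousOn g (sphere 0 1)) (hs : Summable (laurentCoeff f)) (k : ℤ) :
    HasSum (fun l : ℤ => laurentCoeff f l * laurentCoeff g (k - l))
      (laurentCoeff (fun z => f z * g z) k) := by
  obtain ⟨M, hM⟩ := (isCompact_sphere (0 : ℂ) 1).exists_bound_of_continuousOn hg
  have h := hasSum_laurentCoeff (F := fun l z => laurentCoeff f l * (z ^ l * g z))
    (f := fun z => f z * g z) (u := fun l => ‖laurentCoeff f l‖ * M) (hs.norm.mul_right M)
    (fun l => continuousOn_const.mul ((continuousOn_zpow_unitSphere l).mul hg))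
    (fun l z hz => by
      rw [norm_mul, norm_mul, norm_zpow_of_mem_unitSphere hz, one_mul]
      exact mul_le_mul_of_nonneg_left (hM z hz) (norm_nonneg _))
    (fun z hz => by
      simpa only [mul_assoc] using (hasSum_laurentCoeff_mul_zpow hf hs hz).mul_right (g z)) k
  simpa only [laurentCoeff_const_mul, laurentCoeff_zpow_mul] using h

/-- The sum of an absolutely convergent Laurent series on the unit circle. -/
theorem exists_laurentCoeff_eq {a : ℤ → ℂ} (ha : Summable a) :
    ∃ f : ℂ → ℂ, ContinuousOn f (sphere 0 1) ∧ ∀ k, laurentCoeff f k = a k := by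
  have hb : ∀ l, ∀ z ∈ sphere (0 : ℂ) 1, ‖a l * z ^ l‖ ≤ ‖a l‖ := fun l z hz => by
    rw [norm_mul, norm_zpow_of_mem_unitSphere hz, mul_one]
  have hc : ∀ l, ContinuousOn (fun z : ℂ => a l * z ^ l) (sphere 0 1) := fun l =>
    continuousOn_const.mul (continuousOn_zpow_unitSphere l)
  refine ⟨fun z => ∑' l, a l * z ^ l, continuousOn_tsum hc ha.norm hb, fun k => ?_⟩
  have h := hasSum_laurentCoeff ha.norm hc hb
    (fun z hz => (Summable.of_norm_bounded ha.norm fun l => hb l z hz).hasSum) k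
  simp only [laurentCoeff_const_mul, laurentCoeff_zpow, mul_ite, mul_one, mul_zero] at h
  rw [← h.tsum_eq, tsum_eq_single k fun l hl => if_neg hl.symm, if_pos rfl]

/-- The derivative of `f z * z ^ (-k)` integrates to zero over the closed circle. Differentiability
is needed only at points of the circle, so a branch of a logarithm may be used there. -/
theorem laurentCoeff_mul_deriv {f f' : ℂ → ℂ} (hf : ∀ z ∈ sphere (0 : ℂ) 1, HasDerivAt f (f' z) z)
    (hf' : ContinuousOn f' (sphere 0 1)) (k : ℤ) :
    laurentCoeff (fun z => z * f' z) k = k * laurentCoeff f k := by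
  have hfc : ContinuousOn f (sphere 0 1) := fun z hz => (hf z hz).continuousAt.continuousWithinAt
  have h := circleIntegral.integral_eq_zero_of_hasDerivWithinAt (f := fun z => f z * z ^ (-k))
    (f' := fun z => (z * f' z) * z ^ (-k - 1) - k * (f z * z ^ (-k - 1))) (c := 0) (R := 1)
    zero_le_one fun z hz => by
      have h0 := ne_zero_of_mem_unitSphere hz
      refine (((hf z hz).mul (hasDerivAt_zpow (-k) z (Or.inl h0))).congr_deriv ?_).hasDerivWithinAt
      rw [zpow_sub_one₀ h0]
      push_cast
      field_simp
      ring
  have hz := continuousOn_zpow_unitSphere (-k - 1)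
  rw [circleIntegral.integral_sub
    (((continuousOn_id' _).fun_mul hf').fun_mul hz |>.circleIntegrable zero_le_one)
    (((continuousOn_const (c := (k : ℂ))).fun_mul (hfc.fun_mul hz)).circleIntegrable zero_le_one),
    circleIntegral.integral_const_mul, sub_eq_zero] at h
  rw [laurentCoeff, laurentCoeff, h]
  ring

/-! ### Holomorphic functions in discs and annuli -/

theorem laurentCoeff_of_differentiableOn_closedBall {f : ℂ → ℂ} {U : Set ℂ} (hU : IsOpen U)
    (hUb : closedBall 0 1 ⊆ U) (hf : DifferentiableOn ℂ f U) :
    (∀ k < 0, laurentCoeff f k = 0) ∧ laurentCoeff f 0 = f 0 := by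
  constructor
  · intro k hk
    obtain ⟨m, hm⟩ : ∃ m : ℕ, -k - 1 = m := ⟨(-k - 1).toNat, by omega⟩
    rw [laurentCoeff, hm]
    simp only [zpow_natCast]
    have hd : DifferentiableOn ℂ (fun z => f z * z ^ m) U := hf.mul (by fun_prop)
    rw [Complex.circleIntegral_eq_zero_of_differentiable_on_off_countable zero_le_one
      countable_empty (hd.continuousOn.mono hUb), mul_zero]
    exact fun z hz => hd.differentiableAt
      (hU.mem_nhds (hUb (ball_subset_closedBall hz.1)))
  · have h := Complex.circleIntegral_sub_inv_smul_of_differentiable_on_off_countable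
      (R := 1) (c := 0) (w := 0) (f := f) countable_empty (by simp) (hf.continuousOn.mono hUb)
      (fun z hz => hf.differentiableAt (hU.mem_nhds (hUb (ball_subset_closedBall hz.1))))
    have h2 : (∮ z in C(0, 1), f z * z ^ (-0 - 1 : ℤ)) = ∮ z in C(0, 1), (z - 0)⁻¹ • f z := by
      congr 1
      ext z
      simp [mul_comm]
    rw [laurentCoeff, h2, h, smul_eq_mul, ← mul_assoc, inv_mul_cancel₀, one_mul]
    exact Complex.two_pi_I_ne_zero

theorem circleIntegral_eq_of_differentiableOn {f : ℂ → ℂ} {U : Set ℂ} (hU : IsOpen U)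
    (hf : DifferentiableOn ℂ f U) {a b : ℝ} (ha : 0 < a) (hab : a ≤ b)
    (hsub : ∀ z : ℂ, a ≤ ‖z‖ → ‖z‖ ≤ b → z ∈ U) :
    (∮ z in C(0, b), f z) = ∮ z in C(0, a), f z := by
  refine Complex.circleIntegral_eq_of_differentiable_on_annulus_off_countable ha hab
    countable_empty (hf.continuousOn.mono fun z hz => ?_)
    fun z hz => hf.differentiableAt (hU.mem_nhds ?_)
  · simp only [mem_sdiff, mem_closedBall, mem_ball, dist_zero_right, not_lt] at hz
    exact hsub z hz.2 hz.1
  · simp only [mem_sdiff, mem_closedBall, mem_ball, dist_zero_right, not_le] at hz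
    exact hsub z hz.1.2.le hz.1.1.le

theorem laurentCoeff_eq_circleIntegral {f : ℂ → ℂ} {U : Set ℂ} (hU : IsOpen U)
    (hf : DifferentiableOn ℂ f U) {R : ℝ} (hR : 0 < R)
    (hsub : ∀ z : ℂ, min 1 R ≤ ‖z‖ → ‖z‖ ≤ max 1 R → z ∈ U) (k : ℤ) :
    laurentCoeff f k = (2 * π * I)⁻¹ * ∮ z in C(0, R), f z * z ^ (-k - 1) := by
  have hpos : 0 < min 1 R := lt_min one_pos hR
  have hd : DifferentiableOn ℂ (fun z => f z * z ^ (-k - 1)) (U ∩ {0}ᶜ) :=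
    (hf.mono inter_subset_left).mul fun z hz =>
      (differentiableAt_zpow.mpr (Or.inl hz.2)).differentiableWithinAt
  have hU' : IsOpen (U ∩ {0}ᶜ) := hU.inter isOpen_compl_singleton
  have hsub' : ∀ z : ℂ, min 1 R ≤ ‖z‖ → ‖z‖ ≤ max 1 R → z ∈ U ∩ {0}ᶜ := fun z h1 h2 =>
    ⟨hsub z h1 h2, fun h => by
      rw [mem_singleton_iff.mp h, norm_zero] at h1
      exact hpos.not_ge h1⟩
  rw [laurentCoeff]
  congr 1
  rcases le_total 1 R with h | h
  · rw [min_eq_left h, max_eq_right h] at hsub'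
    exact (circleIntegral_eq_of_differentiableOn hU' hd one_pos h hsub').symm
  · rw [min_eq_right h, max_eq_left h] at hsub'
    exact circleIntegral_eq_of_differentiableOn hU' hd hR h hsub'

/-- The contour is moved to radius `R`. Only holomorphy between the two circles is used, so a
function that continues far to one side of the unit circle still has fast decay in that direction.
-/
theorem exists_norm_laurentCoeff_le {f : ℂ → ℂ} {U : Set ℂ} (hU : IsOpen U)
    (hf : DifferentiableOn ℂ f U) {R : ℝ} (hR : 0 < R)
    (hsub : ∀ z : ℂ, min 1 R ≤ ‖z‖ → ‖z‖ ≤ max 1 R → z ∈ U) :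
    ∃ C : ℝ, 0 ≤ C ∧ ∀ k : ℤ, ‖laurentCoeff f k‖ ≤ C * R ^ (-k) := by
  obtain ⟨M, hM⟩ := (isCompact_sphere (0 : ℂ) R).exists_bound_of_continuousOn
    (hf.continuousOn.mono fun z hz => by
      rw [mem_sphere_zero_iff_norm] at hz
      exact hsub z (hz ▸ min_le_right _ _) (hz ▸ le_max_right _ _))
  refine ⟨max M 0, le_max_right _ _, fun k => ?_⟩
  rw [laurentCoeff_eq_circleIntegral hU hf hR hsub]
  have h := circleIntegral.norm_two_pi_i_inv_smul_integral_le_of_norm_le_const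
    (f := fun z => f z * z ^ (-k - 1)) (c := 0) (R := R) (C := max M 0 * R ^ (-k - 1)) hR.le
    fun z hz => by
      rw [norm_mul, norm_zpow, mem_sphere_zero_iff_norm.mp hz]
      exact mul_le_mul_of_nonneg_right ((hM z hz).trans (le_max_left _ _)) (by positivity)
  rw [smul_eq_mul] at h
  refine h.trans_eq ?_
  rw [zpow_sub_one₀ hR.ne']
  field_simp

theorem isOpen_annulus (s : ℝ) : IsOpen (annulus s) :=
  (isOpen_lt continuous_const continuous_norm).inter
    (isOpen_lt (continuous_const.mul continuous_norm) continuous_const)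

theorem sphere_subset_annulus {s : ℝ} (hs : s < 1) : sphere (0 : ℂ) 1 ⊆ annulus s := by
  intro z hz
  rw [mem_sphere_zero_iff_norm] at hz
  exact ⟨by rwa [hz], by rwa [hz, mul_one]⟩

theorem exists_norm_laurentCoeff_le_pow_natAbs {f : ℂ → ℂ} {s t : ℝ} (hs : 0 ≤ s) (hst : s < t)
    (ht : t < 1) (hf : DifferentiableOn ℂ f (annulus s)) :
    ∃ C : ℝ, 0 ≤ C ∧ ∀ k : ℤ, ‖laurentCoeff f k‖ ≤ C * t ^ k.natAbs := by
  have ht0 : 0 < t := hs.trans_lt hst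
  have hti : 1 < t⁻¹ := (one_lt_inv₀ ht0).mpr ht
  obtain ⟨C₁, h₁, hC₁⟩ := exists_norm_laurentCoeff_le (isOpen_annulus s) hf ht0 fun z h1 h2 => by
    rw [min_eq_right ht.le] at h1
    rw [max_eq_left ht.le] at h2
    exact ⟨hst.trans_le h1, by nlinarith⟩
  obtain ⟨C₂, h₂, hC₂⟩ := exists_norm_laurentCoeff_le (isOpen_annulus s) hf (inv_pos.mpr ht0)
    fun z h1 h2 => by
      rw [min_eq_left hti.le] at h1
      rw [max_eq_right hti.le] at h2
      refine ⟨by linarith, ?_⟩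
      calc s * ‖z‖ < t * ‖z‖ := by gcongr
        _ ≤ t * t⁻¹ := by gcongr
        _ = 1 := mul_inv_cancel₀ ht0.ne'
  refine ⟨max C₁ C₂, h₁.trans (le_max_left _ _), fun k => ?_⟩
  rcases le_total 0 k with hk | hk
  · obtain ⟨m, rfl⟩ := Int.eq_ofNat_of_zero_le hk
    refine (hC₂ m).trans ?_
    rw [Int.natAbs_natCast, inv_zpow', neg_neg, zpow_natCast]
    exact mul_le_mul_of_nonneg_right (le_max_right _ _) (by positivity)
  · obtain ⟨m, rfl⟩ : ∃ m : ℕ, k = -m := ⟨k.natAbs, by omega⟩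
    refine (hC₁ _).trans ?_
    rw [Int.natAbs_neg, Int.natAbs_natCast, neg_neg, zpow_natCast]
    exact mul_le_mul_of_nonneg_right (le_max_left _ _) (by positivity)

theorem summable_of_norm_le_pow_natAbs {a : ℤ → ℂ} {C t : ℝ} (ht0 : 0 ≤ t) (ht : t < 1)
    (h : ∀ k, ‖a k‖ ≤ C * t ^ k.natAbs) : Summable a := by
  have hg := (summable_geometric_of_lt_one ht0 ht).mul_left C
  exact .of_nat_of_neg (.of_norm_bounded hg fun n => by simpa using h n)
    (.of_norm_bounded hg fun n => by simpa using h (-n))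

theorem summable_laurentCoeff {f : ℂ → ℂ} {s : ℝ} (hs : 0 ≤ s) (hs1 : s < 1)
    (hf : DifferentiableOn ℂ f (annulus s)) : Summable (laurentCoeff f) := by
  obtain ⟨t, hst, ht⟩ := exists_between hs1
  obtain ⟨C, -, hC⟩ := exists_norm_laurentCoeff_le_pow_natAbs hs hst ht hf
  exact summable_of_norm_le_pow_natAbs (hs.trans hst.le) ht hC

/-- Laurent expansion in an annulus. -/
theorem hasSum_laurentCoeff_of_mem_annulus {f : ℂ → ℂ} {s : ℝ} (hs : 0 ≤ s)
    (hs1 : s < 1) (hf : DifferentiableOn ℂ f (annulus s)) {z : ℂ} (hz : z ∈ annulus s) :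
    HasSum (fun k : ℤ => laurentCoeff f k * z ^ k) (f z) := by
  have hz0 : 0 < ‖z‖ := hs.trans_lt hz.1
  -- The circle through `z` is rescaled to the unit circle; `t` is chosen so that `annulus t`,
  -- scaled by `‖z‖`, stays inside `annulus s`.
  obtain ⟨t, htl, htu⟩ : ∃ t, max s (max (s / ‖z‖) (s * ‖z‖)) < t ∧ t < 1 :=
    exists_between (max_lt hs1 (max_lt ((div_lt_one hz0).mpr hz.1) hz.2))
  have hscale : ∀ ζ ∈ annulus t, (‖z‖ : ℂ) * ζ ∈ annulus s := by
    rintro ζ ⟨h1, h2⟩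
    have hζ : 0 < ‖ζ‖ := (hs.trans ((le_max_left _ _).trans htl.le)).trans_lt h1
    have hn : ‖(‖z‖ : ℂ) * ζ‖ = ‖z‖ * ‖ζ‖ := by simp
    constructor
    · rw [hn, mul_comm, ← div_lt_iff₀ hz0]
      exact ((le_max_left _ _).trans (le_max_right _ _)).trans_lt (htl.trans h1)
    · rw [hn, ← mul_assoc]
      refine lt_of_le_of_lt ?_ h2
      gcongr
      exact ((le_max_right _ _).trans (le_max_right _ _)).trans htl.le
  have hd : DifferentiableOn ℂ (fun ζ => f (‖z‖ * ζ)) (annulus t) :=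
    hf.comp (by fun_prop) hscale
  have ht0 : 0 ≤ t := hs.trans ((le_max_left _ _).trans htl.le)
  have hcoef : ∀ k, laurentCoeff (fun ζ => f (‖z‖ * ζ)) k = laurentCoeff f k * ‖z‖ ^ k := by
    intro k
    have hsub : ∀ v : ℂ, min 1 ‖z‖ ≤ ‖v‖ → ‖v‖ ≤ max 1 ‖z‖ → v ∈ annulus s := fun v h1 h2 => by
      refine ⟨(lt_min hs1 hz.1).trans_le h1, ?_⟩
      refine (mul_le_mul_of_nonneg_left h2 hs).trans_lt ?_
      rw [mul_max_of_nonneg _ _ hs]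
      exact max_lt (by simpa using hs1) hz.2
    have hzc : (‖z‖ : ℂ) ≠ 0 := by exact_mod_cast hz0.ne'
    rw [laurentCoeff_eq_circleIntegral (isOpen_annulus s) hf hz0 hsub, laurentCoeff,
      mul_assoc (2 * π * I : ℂ)⁻¹]
    congr 1
    simp only [circleIntegral]
    rw [← intervalIntegral.integral_mul_const]
    congr 1
    ext θ
    have h1 : circleMap 0 ‖z‖ θ = ‖z‖ * circleMap 0 1 θ := by simp [circleMap]
    have h0 := ne_zero_of_mem_unitSphere (circleMap_zero_one_mem θ)
    simp only [deriv_circleMap, smul_eq_mul]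
    rw [h1, mul_zpow, show -k - 1 = -(k + 1) by ring, zpow_neg (‖z‖ : ℂ), zpow_add_one₀ hzc]
    field_simp
  have hc : ContinuousOn (fun ζ => f (‖z‖ * ζ)) (sphere 0 1) :=
    hd.continuousOn.mono (sphere_subset_annulus htu)
  have h := hasSum_laurentCoeff_mul_zpow hc (summable_laurentCoeff ht0 htu hd)
    (z := z / ‖z‖) (by simp [hz0.ne'])
  have hzc : (‖z‖ : ℂ) ≠ 0 := by exact_mod_cast hz0.ne'
  simp only [hcoef, mul_assoc, ← mul_zpow, mul_div_cancel₀ _ hzc] at h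
  exact h

/-- A power series with geometrically decaying coefficients is holomorphic. -/
theorem differentiableOn_tsum_mul_pow {a : ℕ → ℂ} {s : ℝ} (hs : 0 ≤ s)
    (ha : ∀ t, s < t → t < 1 → ∃ C : ℝ, ∀ k, ‖a k‖ ≤ C * t ^ k) (hs1 : s < 1) :
    DifferentiableOn ℂ (fun z => ∑' k, a k * z ^ k) {z | s * ‖z‖ < 1} ∧
      ∀ z : ℂ, s * ‖z‖ < 1 → Summable fun k => ‖a k * z ^ k‖ := by
  have key : ∀ z : ℂ, s * ‖z‖ < 1 → ∃ U : Set ℂ, IsOpen U ∧ z ∈ U ∧ ∃ u : ℕ → ℝ, Summable u ∧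
      ∀ k, ∀ v ∈ U, ‖a k * v ^ k‖ ≤ u k := by
    intro z hz
    obtain ⟨R, hR, hRs⟩ : ∃ R, ‖z‖ < R ∧ s * R < 1 := by
      rcases hs.eq_or_lt with rfl | h0
      · exact ⟨‖z‖ + 1, by linarith, by simp⟩
      · obtain ⟨R, h1, h2⟩ := exists_between ((lt_div_iff₀' h0).mpr hz)
        exact ⟨R, h1, (lt_div_iff₀' h0).mp h2⟩
    have hR0 : 0 < R := (norm_nonneg z).trans_lt hR
    -- Choosing `t < 1 / R` makes `C * (t * R) ^ k` a summable majorant on the ball of radius `R`.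
    obtain ⟨t, hst, ht⟩ := exists_between (lt_min hs1 ((lt_div_iff₀ hR0).mpr hRs))
    obtain ⟨C, hC⟩ := ha t hst (ht.trans_le (min_le_left _ _))
    have htR : t * R < 1 := (lt_div_iff₀ hR0).mp (ht.trans_le (min_le_right _ _))
    have ht0 : 0 ≤ t := hs.trans hst.le
    refine ⟨ball 0 R, isOpen_ball, by simpa using hR, fun k => C * (t * R) ^ k,
      (summable_geometric_of_lt_one (by positivity) htR).mul_left C, fun k v hv => ?_⟩
    rw [norm_mul, norm_pow]
    beta_reduce
    rw [mul_pow, ← mul_assoc]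
    have hv' : ‖v‖ ≤ R := (mem_ball_zero_iff.mp hv).le
    have hC0 : 0 ≤ C * t ^ k := (norm_nonneg _).trans (hC k)
    exact mul_le_mul (hC k) (by gcongr) (by positivity) hC0
  refine ⟨fun z hz => ?_, fun z hz => ?_⟩
  · obtain ⟨U, hU, hzU, u, hu, hb⟩ := key z hz
    exact ((Complex.differentiableOn_tsum_of_summable_norm hu (fun k => by fun_prop) hU
      hb).differentiableAt (hU.mem_nhds hzU)).differentiableWithinAt
  · obtain ⟨U, -, hzU, u, hu, hb⟩ := key z hz
    exact .of_nonneg_of_le (fun _ => norm_nonneg _) (fun k => hb k z hzU) hu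

/-! ### The Szegő function -/

theorem exists_circle_coe_eq {z : ℂ} (hz : z ∈ sphere (0 : ℂ) 1) : ∃ c : Circle, (c : ℂ) = z :=
  ⟨⟨z, mem_sphere_zero_iff_norm.mpr (mem_sphere_zero_iff_norm.mp hz)⟩, rfl⟩

/-- The kernel is `2 (1 - z/e)⁻¹ - 1`, and the geometric series in `z/e` converges uniformly on the
circle. -/
theorem laurentCoeff_mul_herglotz_of_norm_lt_one {f : ℂ → ℂ} (hf : ContinuousOn f (sphere 0 1))
    {z : ℂ} (hz : ‖z‖ < 1) :
    laurentCoeff (fun e => f e * ((e + z) / (e - z))) 0 =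
      2 * (∑' k : ℕ, laurentCoeff f k * z ^ k) - laurentCoeff f 0 := by
  obtain ⟨M, hM⟩ := (isCompact_sphere (0 : ℂ) 1).exists_bound_of_continuousOn hf
  have hne : ∀ e ∈ sphere (0 : ℂ) 1, e - z ≠ 0 := fun e he h => by
    rw [← sub_eq_zero.mp h, mem_sphere_zero_iff_norm.mp he] at hz
    exact lt_irrefl _ hz
  have hzp := fun k : ℕ => continuousOn_zpow_unitSphere (-(k : ℤ))
  have hc : ContinuousOn (fun e => f e * (1 - z / e)⁻¹) (sphere 0 1) := by
    refine hf.fun_mul (ContinuousOn.inv₀ (continuousOn_const.sub (continuousOn_const.div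
      continuousOn_id fun e he => ne_zero_of_mem_unitSphere he)) fun e he => ?_)
    have h0 := ne_zero_of_mem_unitSphere he
    rw [one_sub_div h0]
    exact div_ne_zero (hne e he) h0
  have h := hasSum_laurentCoeff (F := fun (k : ℕ) e => z ^ k * (e ^ (-(k : ℤ)) * f e))
    (f := fun e => f e * (1 - z / e)⁻¹) (u := fun k => ‖z‖ ^ k * M)
    ((summable_geometric_of_lt_one (norm_nonneg z) hz).mul_right M)
    (fun k => continuousOn_const.fun_mul ((hzp k).fun_mul hf))
    (fun k e he => by
      rw [norm_mul, norm_mul, norm_zpow_of_mem_unitSphere he, one_mul, norm_pow]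
      exact mul_le_mul_of_nonneg_left (hM e he) (by positivity))
    (fun e he => by
      have h1 : ‖z / e‖ < 1 := by rwa [norm_div, mem_sphere_zero_iff_norm.mp he, div_one]
      refine ((hasSum_geometric_of_norm_lt_one h1).mul_left (f e)).congr_fun fun k => ?_
      rw [div_pow, zpow_neg, zpow_natCast]
      ring) 0
  simp only [laurentCoeff_const_mul, laurentCoeff_zpow_mul, zero_sub, neg_neg] at h
  simp only [mul_comm (laurentCoeff f _)]
  rw [h.tsum_eq, ← laurentCoeff_const_mul, ← laurentCoeff_sub (continuousOn_const.fun_mul hc) hf]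
  refine laurentCoeff_congr (fun e he => ?_) 0
  have h0 := ne_zero_of_mem_unitSphere he
  have h1 := hne e he
  rw [one_sub_div h0]
  field_simp
  ring

/-- Inverting both `e` and `z` changes the sign of the kernel, which reduces the exterior to the
interior case. -/
theorem laurentCoeff_mul_herglotz_of_one_lt_norm {f : ℂ → ℂ} (hf : ContinuousOn f (sphere 0 1))
    {z : ℂ} (hz : 1 < ‖z‖) :
    laurentCoeff (fun e => f e * ((e + z) / (e - z))) 0 =
      -(2 * (∑' k : ℕ, laurentCoeff f (-k) * z⁻¹ ^ k) - laurentCoeff f 0) := by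
  have hinv : MapsTo (fun e : ℂ => e⁻¹) (sphere 0 1) (sphere 0 1) := fun e he => by
    rw [mem_sphere_zero_iff_norm] at he ⊢
    rw [norm_inv, he, inv_one]
  have hc : ContinuousOn (fun e => f e⁻¹) (sphere 0 1) :=
    hf.comp (continuousOn_id.inv₀ fun e he => ne_zero_of_mem_unitSphere he) hinv
  have h := laurentCoeff_mul_herglotz_of_norm_lt_one hc (z := z⁻¹)
    (by rw [norm_inv]; exact inv_lt_one_of_one_lt₀ hz)
  simp only [laurentCoeff_comp_inv, neg_zero] at h
  rw [← h, ← neg_zero, ← laurentCoeff_comp_inv, neg_zero, ← neg_one_mul,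
    ← laurentCoeff_const_mul]
  refine laurentCoeff_congr (fun e he => ?_) 0
  have h0 := ne_zero_of_mem_unitSphere he
  have hz0 : z ≠ 0 := norm_pos_iff.mp (one_pos.trans hz)
  have h2 : 1 - e * z ≠ 0 := fun h => by
    have h3 := congrArg norm (sub_eq_zero.mp h)
    rw [norm_mul, mem_sphere_zero_iff_norm.mp he, norm_one, one_mul] at h3
    exact hz.ne h3
  have h3 : e * z - 1 ≠ 0 := fun h => h2 (by rw [← neg_sub, h, neg_zero])
  have e1 : (e⁻¹ + z) / (e⁻¹ - z) = (1 + e * z) / (1 - e * z) := by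
    rw [← mul_div_mul_left _ _ h0, mul_add, mul_sub, mul_inv_cancel₀ h0]
  have e2 : (e + z⁻¹) / (e - z⁻¹) = (e * z + 1) / (e * z - 1) := by
    rw [← mul_div_mul_right _ _ hz0, add_mul, sub_mul, inv_mul_cancel₀ hz0]
  rw [e1, e2]
  field_simp
  rw [← neg_sub (e * z) 1]
  field_simp
  ring

theorem szegoD_eq_exp_laurentCoeff {w : Circle → ℝ} {f : ℂ → ℂ}
    (hf : ∀ z : Circle, f z = (Real.log (w z) : ℂ)) (z : ℂ) :
    szegoD w z = exp (1 / 2 * laurentCoeff (fun e => f e * ((e + z) / (e - z))) 0) := by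
  have h : ∀ θ : ℝ, circleMap 0 1 θ = (Circle.exp θ : ℂ) := fun θ => by
    simp [circleMap]
  rw [szegoD, laurentCoeff_eq_intervalIntegral]
  simp only [h, hf, neg_zero, zpow_zero, mul_one]
  congr 1
  rw [← mul_assoc]
  congr 1
  have : (π : ℂ) ≠ 0 := by exact_mod_cast Real.pi_ne_zero
  field_simp
  norm_num

/-- The logarithm of the Szegő function and its continuation: the analytic part `h₊` and the
reflection `h₋` of the antianalytic part of `log w`. -/
theorem exists_log_szegoD {w : Circle → ℝ} (hpos : ∀ z, 0 < w z) {s : ℝ} (hs : 0 ≤ s)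
    (hs1 : s < 1) {W : ℂ → ℂ} (hW : DifferentiableOn ℂ W (annulus s))
    (hW0 : ∀ z ∈ annulus s, W z ≠ 0) (hWw : ∀ z : Circle, W z = w z) :
    ∃ hp hm : ℂ → ℂ, DifferentiableOn ℂ hp {z | s * ‖z‖ < 1} ∧
      DifferentiableOn ℂ hm {z | s * ‖z‖ < 1} ∧ hp 0 = hm 0 ∧
      (∀ z : ℂ, ‖z‖ < 1 → exp (hp z) = szegoD w z) ∧
      (∀ z : ℂ, 1 < ‖z‖ → exp (-hm z⁻¹) = szegoD w z) ∧
      (∀ z : Circle, hp z + hm (z : ℂ)⁻¹ = (Real.log (w z) : ℂ)) ∧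
      ∀ z ∈ sphere (0 : ℂ) 1, hm z⁻¹ = conj (hp z) := by
  -- The principal logarithm is holomorphic near the circle, where `W > 0`, but perhaps not on the
  -- whole annulus. The decay of its coefficients is therefore read off from `z W' / W`, which is
  -- holomorphic there.
  set f : ℂ → ℂ := fun z => log (W z) with hfdef
  have hsub := sphere_subset_annulus hs1
  have hfw : ∀ z : Circle, f z = (Real.log (w z) : ℂ) := fun z => by
    rw [hfdef, ofReal_log (hpos z).le, ← hWw]
  have hd : ∀ z ∈ sphere (0 : ℂ) 1, HasDerivAt f (deriv W z / W z) z := fun z hz =>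
    (hW.hasDerivAt ((isOpen_annulus s).mem_nhds (hsub hz))).clog (by
      obtain ⟨c, rfl⟩ := exists_circle_coe_eq hz
      rw [hWw]
      exact Complex.ofReal_mem_slitPlane.mpr (hpos _))
  have hfc : ContinuousOn f (sphere 0 1) := fun z hz => (hd z hz).continuousAt.continuousWithinAt
  have hqd : DifferentiableOn ℂ (fun z => deriv W z / W z) (annulus s) :=
    (hW.deriv (isOpen_annulus s)).div hW hW0
  have hdecay : ∀ t, s < t → t < 1 →
      ∃ C : ℝ, ∀ k : ℤ, ‖laurentCoeff f k‖ ≤ C * t ^ k.natAbs := by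
    intro t hst ht
    obtain ⟨C, hC0, hC⟩ := exists_norm_laurentCoeff_le_pow_natAbs hs hst ht
      (differentiableOn_id.fun_mul hqd)
    refine ⟨max C ‖laurentCoeff f 0‖, fun k => ?_⟩
    rcases eq_or_ne k 0 with rfl | hk
    · simp
    · have h1 := hC k
      simp only [id_eq] at h1
      rw [laurentCoeff_mul_deriv hd (hqd.continuousOn.mono hsub), norm_mul, norm_intCast] at h1
      have h2 : (1 : ℝ) ≤ |(k : ℝ)| := by exact_mod_cast Int.one_le_abs hk
      have h3 : 0 ≤ t := hs.trans hst.le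
      calc ‖laurentCoeff f k‖ ≤ |(k : ℝ)| * ‖laurentCoeff f k‖ :=
            le_mul_of_one_le_left (norm_nonneg _) h2
        _ ≤ C * t ^ k.natAbs := h1
        _ ≤ _ := mul_le_mul_of_nonneg_right (le_max_left _ _) (by positivity)
  obtain ⟨hpd, hps⟩ := differentiableOn_tsum_mul_pow (a := fun k => laurentCoeff f k) hs
    (fun t hst ht => (hdecay t hst ht).imp fun C hC k => by simpa using hC k) hs1
  obtain ⟨hmd, hms⟩ := differentiableOn_tsum_mul_pow (a := fun k => laurentCoeff f (-k)) hs
    (fun t hst ht => (hdecay t hst ht).imp fun C hC k => by simpa using hC (-k)) hs1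
  have hsum : Summable (laurentCoeff f) := by
    obtain ⟨t, hst, ht⟩ := exists_between hs1
    obtain ⟨C, hC⟩ := hdecay t hst ht
    exact summable_of_norm_le_pow_natAbs (hs.trans hst.le) ht hC
  have hreal : ∀ k, laurentCoeff f (-k) = conj (laurentCoeff f k) := fun k => by
    rw [← neg_neg k, ← laurentCoeff_conj, neg_neg]
    refine laurentCoeff_congr (fun z hz => ?_) _
    obtain ⟨c, rfl⟩ := exists_circle_coe_eq hz
    simp only [hfw, conj_ofReal]
  have htsum0 : ∀ a : ℕ → ℂ, ∑' k, a k * (0 : ℂ) ^ k = a 0 := fun a => by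
    rw [tsum_eq_single 0 fun k hk => by rw [zero_pow hk, mul_zero], pow_zero, mul_one]
  -- The zeroth coefficient occurs in both one-sided series, so each gives up half of it. This is
  -- also what the Herglotz integral produces, and it makes the values at `0` equal.
  refine ⟨fun z => (∑' k : ℕ, laurentCoeff f k * z ^ k) - laurentCoeff f 0 / 2,
    fun z => (∑' k : ℕ, laurentCoeff f (-k) * z ^ k) - laurentCoeff f 0 / 2,
    hpd.sub_const _, hmd.sub_const _, ?_, ?_, ?_, ?_, ?_⟩
  · simp only
    rw [htsum0 fun k : ℕ => laurentCoeff f k, htsum0 fun k : ℕ => laurentCoeff f (-k)]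
    simp
  · intro z hz
    rw [szegoD_eq_exp_laurentCoeff hfw, laurentCoeff_mul_herglotz_of_norm_lt_one hfc hz]
    congr 1
    ring
  · intro z hz
    rw [szegoD_eq_exp_laurentCoeff hfw, laurentCoeff_mul_herglotz_of_one_lt_norm hfc hz]
    congr 1
    ring
  · intro z
    have hn : ‖(z : ℂ)‖ = 1 := Circle.norm_coe z
    have hz : (z : ℂ) ∈ sphere (0 : ℂ) 1 := mem_sphere_zero_iff_norm.mpr hn
    have h := (hasSum_laurentCoeff_mul_zpow hfc hsum hz).nat_add_neg
    have h1 := (hps z (by rwa [hn, mul_one])).of_norm.hasSum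
    have h2 := (hms (z : ℂ)⁻¹ (by rwa [norm_inv, hn, inv_one, mul_one])).of_norm.hasSum
    have h3 := h.unique ((h1.add h2).congr_fun fun k => by
      rw [zpow_neg, zpow_natCast, inv_pow])
    rw [← hfw]
    simp only [zpow_zero, mul_one] at h3
    linear_combination -h3
  · intro z hz
    -- `log w` is real, so its coefficients at `k` and `-k` are conjugate.
    have hc : z⁻¹ = conj z := Complex.inv_eq_conj (mem_sphere_zero_iff_norm.mp hz)
    have h0 : conj (laurentCoeff f 0) = laurentCoeff f 0 := by rw [← hreal, neg_zero]
    simp only [map_sub, map_div₀, h0, Complex.conj_tsum, map_mul, map_pow, hc, hreal,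
      Complex.conj_ofNat]

/-! ### Boundary values and continuation across the circle. -/

theorem mem_closure_norm_lt_one {z : ℂ} (hz : ‖z‖ = 1) : z ∈ closure {z : ℂ | ‖z‖ < 1} := by
  have h : {z : ℂ | ‖z‖ < 1} = ball 0 1 := by ext; simp
  rw [h, closure_ball 0 one_ne_zero]
  simp [hz]

theorem mem_closure_one_lt_norm {z : ℂ} (hz : ‖z‖ = 1) : z ∈ closure {z : ℂ | 1 < ‖z‖} := by
  have h : {z : ℂ | 1 < ‖z‖} = (closedBall 0 1)ᶜ := by ext; simp
  rw [h, closure_compl, interior_closedBall 0 one_ne_zero]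
  simp [hz]

theorem extendFrom_eq_of_eqOn {A : Set ℂ} {f g : ℂ → ℂ} {z : ℂ} (hz : z ∈ closure A)
    (hg : ContinuousAt g z) (h : EqOn g f A) : extendFrom A f z = g z :=
  extendFrom_eq hz ((hg.mono_left nhdsWithin_le_nhds).congr' (eventually_mem_nhdsWithin.mono h))

theorem isOpen_mul_norm_lt_one (s : ℝ) : IsOpen {z : ℂ | s * ‖z‖ < 1} :=
  isOpen_lt (continuous_const.mul continuous_norm) continuous_const

theorem isOpen_lt_norm (s : ℝ) : IsOpen {z : ℂ | s < ‖z‖} :=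
  isOpen_lt continuous_const continuous_norm

theorem differentiableOn_comp_inv {h : ℂ → ℂ} {s : ℝ} (hs : 0 ≤ s)
    (hh : DifferentiableOn ℂ h {z | s * ‖z‖ < 1}) :
    DifferentiableOn ℂ (fun z => h z⁻¹) {z | s < ‖z‖} := by
  refine hh.comp (differentiableOn_inv.mono fun z hz => ?_) fun z hz => ?_
  · exact norm_pos_iff.mp (hs.trans_lt hz)
  · have hz' : s < ‖z‖ := hz
    rw [mem_ofPred_eq, norm_inv, ← div_eq_mul_inv]
    exact (div_lt_one (hs.trans_lt hz')).mpr hz'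

/-- The continuations are continuous at points of the circle, so the boundary limits defining
`szegoInt` and `szegoExt` exist there and equal their values. -/
theorem szego_continuation {w : Circle → ℝ} (hpos : ∀ z, 0 < w z) {s : ℝ} (hs : 0 ≤ s)
    (hs1 : s < 1) {W : ℂ → ℂ} (hW : DifferentiableOn ℂ W (annulus s))
    (hW0 : ∀ z ∈ annulus s, W z ≠ 0) (hWw : ∀ z : Circle, W z = w z) :
    ∃ hp hm : ℂ → ℂ, DifferentiableOn ℂ hp {z | s * ‖z‖ < 1} ∧
      DifferentiableOn ℂ hm {z | s * ‖z‖ < 1} ∧ hp 0 = hm 0 ∧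
      (∀ z : ℂ, ‖z‖ < 1 → exp (hp z) = szegoD w z) ∧
      (∀ z : ℂ, 1 < ‖z‖ → exp (-hm z⁻¹) = szegoD w z) ∧
      (∀ z : Circle, hp z + hm (z : ℂ)⁻¹ = (Real.log (w z) : ℂ)) ∧
      (∀ z ∈ sphere (0 : ℂ) 1, hm z⁻¹ = conj (hp z)) ∧
      ∀ z : ℂ, ‖z‖ = 1 → exp (hp z) = szegoInt w z ∧ exp (-hm z⁻¹) = szegoExt w z := by
  obtain ⟨hp, hm, hpd, hmd, h0, hi, he, hlog, hconj⟩ := exists_log_szegoD hpos hs hs1 hW hW0 hWw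
  refine ⟨hp, hm, hpd, hmd, h0, hi, he, hlog, hconj, fun z hz => ⟨?_, ?_⟩⟩
  · refine (extendFrom_eq_of_eqOn (mem_closure_norm_lt_one hz)
      (hpd.cexp.differentiableAt ((isOpen_mul_norm_lt_one s).mem_nhds ?_)).continuousAt hi).symm
    simpa [hz] using hs1
  · refine (extendFrom_eq_of_eqOn (g := fun z => exp (-hm z⁻¹)) (mem_closure_one_lt_norm hz)
      ((differentiableOn_comp_inv hs hmd).neg.cexp.differentiableAt
        ((isOpen_lt_norm s).mem_nhds ?_)).continuousAt he).symm
    simpa [hz] using hs1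

theorem exists_szego_continuation_hasSum {w : Circle → ℝ} (hpos : ∀ z, 0 < w z) {s : ℝ}
    (hs : 0 ≤ s) (hs1 : s < 1)
    (h : ∃ W : ℂ → ℂ, DifferentiableOn ℂ W (annulus s) ∧ (∀ z ∈ annulus s, W z ≠ 0) ∧
        ∀ z : Circle, W z = w z) :
    ∃ Di De : ℂ → ℂ,
      DifferentiableOn ℂ Di {z | s * ‖z‖ < 1} ∧ (∀ z : ℂ, ‖z‖ < 1 → Di z = szegoD w z) ∧
      DifferentiableOn ℂ De {z | s < ‖z‖} ∧ (∀ z : ℂ, 1 < ‖z‖ → De z = szegoD w z) ∧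
      (∀ z : ℂ, ‖z‖ = 1 → Di z = szegoInt w z ∧ De z = szegoExt w z) ∧
      ∀ z ∈ annulus s, Di z * De z ≠ 0 ∧
        HasSum (fun k : ℤ => laurentCoeff (fun t => 1 / scattering w t) k * z ^ k)
          (1 / (Di z * De z)) := by
  obtain ⟨W, hW, hW0, hWw⟩ := h
  obtain ⟨hp, hm, hpd, hmd, -, hi, he, -, -, hb⟩ := szego_continuation hpos hs hs1 hW hW0 hWw
  have hDe := (differentiableOn_comp_inv hs hmd).neg.cexp
  refine ⟨fun z => exp (hp z), fun z => exp (-hm z⁻¹), hpd.cexp, hi, hDe, he, hb,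
    fun z hz => ⟨mul_ne_zero (exp_ne_zero _) (exp_ne_zero _), ?_⟩⟩
  have hd : DifferentiableOn ℂ (fun z => 1 / (exp (hp z) * exp (-hm z⁻¹))) (annulus s) :=
    (differentiableOn_const 1).div
      ((hpd.cexp.mono fun z hz => hz.2).mul (hDe.mono fun z hz => hz.1))
      fun z _ => mul_ne_zero (exp_ne_zero _) (exp_ne_zero _)
  have hcongr : EqOn (fun t => 1 / scattering w t) (fun z => 1 / (exp (hp z) * exp (-hm z⁻¹)))
      (sphere 0 1) := fun t ht => by
    have h1 := hb t (mem_sphere_zero_iff_norm.mp ht)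
    simp only [scattering, h1.1, h1.2]
  simp only [laurentCoeff_congr hcongr]
  exact hasSum_laurentCoeff_of_mem_annulus hs hs1 hd hz

/-! ### Products of one-sided series and the coupled system -/

theorem laurentCoeff_mul_of_nonneg_support {f g : ℂ → ℂ} (hf : ContinuousOn f (sphere 0 1))
    (hg : ContinuousOn g (sphere 0 1)) (hs : Summable (laurentCoeff f))
    (hf0 : ∀ k < 0, laurentCoeff f k = 0) (hg0 : ∀ k < 0, laurentCoeff g k = 0) :
    (∀ k < 0, laurentCoeff (fun z => f z * g z) k = 0) ∧
      laurentCoeff (fun z => f z * g z) 0 = laurentCoeff f 0 * laurentCoeff g 0 := by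
  have h := hasSum_laurentCoeff_mul hf hg hs
  have hz : ∀ k ≤ 0, ∀ l ≠ 0, laurentCoeff f l * laurentCoeff g (k - l) = 0 := by
    intro k hk l hl
    rcases lt_or_gt_of_ne hl with h1 | h1
    · rw [hf0 l h1, zero_mul]
    · rw [hg0 _ (by omega), mul_zero]
  refine ⟨fun k hk => ?_, ?_⟩
  · rw [(h k).unique (hasSum_single 0 (hz k hk.le)), sub_zero, hg0 k hk, mul_zero]
  · rw [(h 0).unique (hasSum_single 0 (hz 0 le_rfl)), sub_zero]

theorem laurentCoeff_mul_of_nonpos_support {f g : ℂ → ℂ} (hf : ContinuousOn f (sphere 0 1))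
    (hg : ContinuousOn g (sphere 0 1)) (hs : Summable (laurentCoeff f))
    (hf0 : ∀ k > 0, laurentCoeff f k = 0) (hg0 : ∀ k > 0, laurentCoeff g k = 0) :
    (∀ k > 0, laurentCoeff (fun z => f z * g z) k = 0) ∧
      laurentCoeff (fun z => f z * g z) 0 = laurentCoeff f 0 * laurentCoeff g 0 := by
  have h := hasSum_laurentCoeff_mul hf hg hs
  have hz : ∀ k ≥ 0, ∀ l ≠ 0, laurentCoeff f l * laurentCoeff g (k - l) = 0 := by
    intro k hk l hl
    rcases lt_or_gt_of_ne hl with h1 | h1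
    · rw [hg0 _ (by omega), mul_zero]
    · rw [hf0 l h1, zero_mul]
  refine ⟨fun k hk => ?_, ?_⟩
  · rw [(h k).unique (hasSum_single 0 (hz k hk.le)), sub_zero, hg0 k hk, mul_zero]
  · rw [(h 0).unique (hasSum_single 0 (hz 0 le_rfl)), sub_zero]

theorem norm_le_of_hasSum_int {x : ℤ → ℂ} {a : ℂ} (h : HasSum x a) (hneg : ∀ l < 0, x l = 0)
    {D t : ℝ} (ht0 : 0 ≤ t) (ht1 : t < 1) (hb : ∀ j : ℕ, ‖x j‖ ≤ D * t ^ j) :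
    ‖a‖ ≤ D * (1 - t)⁻¹ := by
  have h1 : HasSum (fun j : ℕ => x j) a :=
    (Nat.cast_injective (R := ℤ)).hasSum_iff (fun l hl => hneg l (by
      by_contra! hcon
      exact hl ⟨l.toNat, Int.toNat_of_nonneg hcon⟩)) |>.mpr h
  exact h1.norm_le_of_bounded ((hasSum_geometric_of_lt_one ht0 ht1).mul_left D) hb

/-- If `q` and `p` have one-sided supports and are coupled through convolutions with
geometrically decaying sequences `u`, `v`, then `q` is close to its zeroth coefficient. -/
theorem norm_sub_le_of_coupled {u v q p uq vp : ℤ → ℂ} {n : ℕ} {X Z : ℂ} {C Q t : ℝ}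
    (hC : 0 ≤ C) (ht0 : 0 ≤ t) (ht1 : t < 1)
    (hu : ∀ k : ℕ, ‖u k‖ ≤ C * t ^ k) (hv : ∀ k : ℕ, ‖v (-k)‖ ≤ C * t ^ k)
    (huq : ∀ k, HasSum (fun l => u l * q (k - l)) (uq k))
    (hvp : ∀ k, HasSum (fun l => v l * p (k - l)) (vp k))
    (hp : ∀ k < 0, p k = 0) (hq : ∀ k > 0, q k = 0) (hQ : ∀ k, ‖q k‖ ≤ Q)
    (e1 : ∀ k < 0, q k + vp (k - (n + 1)) = 0) (e1' : q 0 + vp (0 - (n + 1)) = X)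
    (e2 : ∀ k > (n : ℤ), uq k + p (k - (n + 1)) = 0) (e2' : uq n + p (n - (n + 1)) = Z) :
    ‖Z - X * u n‖ ≤ (Q * C ^ 3 * (1 - t)⁻¹ ^ 3 + Q * C ^ 3 * (1 - t)⁻¹ ^ 2) * t ^ (3 * n) := by
  have hQ0 : 0 ≤ Q := (norm_nonneg _).trans (hQ 0)
  have hT : 0 ≤ (1 - t)⁻¹ := inv_nonneg.mpr (by linarith)
  have huq' : ∀ k, HasSum (fun i => u (k + i) * q (-i)) (uq k) := fun k => by
    refine (((Equiv.addLeft k).hasSum_iff).mpr (huq k)).congr_fun fun i => ?_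
    simp
  have hvp' : ∀ k, HasSum (fun j => v (k - j) * p j) (vp k) := fun k => by
    refine (((Equiv.subLeft k).hasSum_iff).mpr (hvp k)).congr_fun fun i => ?_
    simp
  -- First gain of `t ^ n`: above frequency `n`, `p` cancels `u * q`, and since `q` has only
  -- nonpositive frequencies just the small tail of `u` enters.
  have hpb : ∀ j : ℕ, ‖p j‖ ≤ Q * C * (1 - t)⁻¹ * t ^ (n + j) := by
    intro j
    have h1 := e2 ((n + 1 + j : ℕ) : ℤ) (by push_cast; omega)
    rw [show ((n + 1 + j : ℕ) : ℤ) - (n + 1) = j by push_cast; ring] at h1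
    rw [eq_neg_of_add_eq_zero_right h1, norm_neg]
    refine (norm_le_of_hasSum_int (D := Q * C * t ^ (n + j)) (huq' _) (fun l hl => ?_) ht0 ht1
      fun i => ?_).trans_eq (by ring)
    · rw [hq _ (by omega), mul_zero]
    · have h2 := hu (n + 1 + j + i)
      rw [norm_mul, ← Nat.cast_add]
      calc _ ≤ (C * t ^ (n + 1 + j + i)) * Q :=
            mul_le_mul h2 (hQ _) (norm_nonneg _) (by positivity)
        _ = Q * C * t ^ (n + j) * t ^ i * t := by ring
        _ ≤ Q * C * t ^ (n + j) * t ^ i := mul_le_of_le_one_right (by positivity) ht1.le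
  -- Second gain: only far negative coefficients of `v` meet `p`, which is already of order `t ^ n`.
  have hvpb : ∀ m : ℕ, ‖vp (-m - (n + 1))‖ ≤ Q * C ^ 2 * (1 - t)⁻¹ ^ 2 * t ^ (2 * n + m) := by
    intro m
    refine (norm_le_of_hasSum_int (D := Q * C ^ 2 * (1 - t)⁻¹ * t ^ (2 * n + m)) (hvp' _)
      (fun l hl => ?_) ht0 ht1 fun j => ?_).trans_eq (by ring)
    · rw [hp _ hl, mul_zero]
    · have h2 := hv (m + n + 1 + j)
      rw [norm_mul, show (-m - (n + 1) - j : ℤ) = -((m + n + 1 + j : ℕ) : ℤ) by push_cast; ring]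
      calc _ ≤ (C * t ^ (m + n + 1 + j)) * (Q * C * (1 - t)⁻¹ * t ^ (n + j)) :=
            mul_le_mul h2 (hpb j) (norm_nonneg _) (by positivity)
        _ = Q * C ^ 2 * (1 - t)⁻¹ * t ^ (2 * n + m) * t ^ j * t ^ (j + 1) := by ring
        _ ≤ _ := mul_le_of_le_one_right (by positivity) (pow_le_one₀ ht0 ht1.le)
  have hqb : ∀ m : ℕ, 0 < m → ‖q (-m)‖ ≤ Q * C ^ 2 * (1 - t)⁻¹ ^ 2 * t ^ (2 * n + m) := by
    intro m hm
    rw [eq_neg_of_add_eq_zero_left (e1 (-m) (by omega)), norm_neg]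
    exact hvpb m
  -- Third gain: once the `q 0` term is removed, the convolution pairs coefficients of `u` beyond
  -- `n` with negative coefficients of `q` of order `t ^ (2 * n)`.
  have hrem : ‖uq n - u n * q 0‖ ≤ Q * C ^ 3 * (1 - t)⁻¹ ^ 3 * t ^ (3 * n) := by
    have h := (huq' n).sub (hasSum_ite_eq (0 : ℤ) (u n * q 0))
    refine (norm_le_of_hasSum_int (D := Q * C ^ 3 * (1 - t)⁻¹ ^ 2 * t ^ (3 * n)) h
      (fun l hl => ?_) ht0 ht1 fun i => ?_).trans_eq (by ring)
    · rw [hq _ (by omega), mul_zero, if_neg hl.ne, sub_zero]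
    · rcases Nat.eq_zero_or_pos i with rfl | hi
      · simp only [Nat.cast_zero, add_zero, neg_zero, if_true, sub_self, norm_zero]
        positivity
      · rw [if_neg (by exact_mod_cast hi.ne'), sub_zero, norm_mul, ← Nat.cast_add]
        calc _ ≤ (C * t ^ (n + i)) * (Q * C ^ 2 * (1 - t)⁻¹ ^ 2 * t ^ (2 * n + i)) :=
              mul_le_mul (hu _) (hqb i hi) (norm_nonneg _) (by positivity)
          _ = Q * C ^ 3 * (1 - t)⁻¹ ^ 2 * t ^ (3 * n) * t ^ i * t ^ i := by ring
          _ ≤ _ := mul_le_of_le_one_right (by positivity) (pow_le_one₀ ht0 ht1.le)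
  have h0 : ‖vp (0 - (n + 1)) * u n‖ ≤ Q * C ^ 3 * (1 - t)⁻¹ ^ 2 * t ^ (3 * n) := by
    have h1 := hvpb 0
    rw [Nat.cast_zero, neg_zero, add_zero] at h1
    rw [norm_mul]
    calc _ ≤ (Q * C ^ 2 * (1 - t)⁻¹ ^ 2 * t ^ (2 * n)) * (C * t ^ n) :=
          mul_le_mul h1 (hu n) (norm_nonneg _) (by positivity)
      _ = _ := by ring
  have hp1 : p (n - (n + 1)) = 0 := hp _ (by omega)
  have heq : Z - X * u n = (uq n - u n * q 0) - vp (0 - (n + 1)) * u n := by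
    rw [← e2', ← e1', hp1]
    ring
  rw [heq, add_mul]
  exact (norm_sub_le _ _).trans (add_le_add hrem h0)

/-- Let `Y` have Laurent coefficients supported in `[0, n]` and let the coefficients of
`Y di / de` vanish on `[1, n]`. Then the top coefficient of `Y` is determined, up to an error of
third order, by the coefficients of `1 / (di de)`. -/
theorem norm_top_laurentCoeff_sub_le {Y di de : ℂ → ℂ} {s : ℝ} (hs : 0 ≤ s) (hs1 : s < 1)
    (hY : DifferentiableOn ℂ Y (annulus s)) (hdi : DifferentiableOn ℂ di (annulus s))
    (hde : DifferentiableOn ℂ de (annulus s)) (hdi0 : ∀ z, di z ≠ 0) (hde0 : ∀ z, de z ≠ 0)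
    (di_supp : ∀ k < 0, laurentCoeff di k = 0)
    (di_inv_supp : ∀ k < 0, laurentCoeff (fun z => (di z)⁻¹) k = 0)
    (de_supp : ∀ k > 0, laurentCoeff de k = 0)
    (de_inv_supp : ∀ k > 0, laurentCoeff (fun z => (de z)⁻¹) k = 0)
    {n : ℕ} (Y_neg : ∀ k < 0, laurentCoeff Y k = 0)
    (Y_gt : ∀ k > (n : ℤ), laurentCoeff Y k = 0)
    (hgap : ∀ k : ℤ, 1 ≤ k → k ≤ n → laurentCoeff (fun z => Y z * (di z / de z)) k = 0)
    {C M t : ℝ} (hC : 0 ≤ C) (ht0 : 0 ≤ t) (ht1 : t < 1)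
    (hM : ∀ k, ‖laurentCoeff (fun z => Y z * (di z / de z)) k‖ ≤ M)
    (hu : ∀ k : ℕ, ‖laurentCoeff (fun z => 1 / (di z * de z)) k‖ ≤ C * t ^ k)
    (hv : ∀ k : ℕ, ‖laurentCoeff (fun z => di z * de z) (-k)‖ ≤ C * t ^ k) :
    ‖laurentCoeff (fun z => (de z)⁻¹) 0 * laurentCoeff Y n -
        laurentCoeff di 0 * laurentCoeff Y 0 * laurentCoeff (fun z => 1 / (di z * de z)) n‖ ≤
      ((∑' k, ‖laurentCoeff de k‖) * M * C ^ 3 * (1 - t)⁻¹ ^ 3 +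
        (∑' k, ‖laurentCoeff de k‖) * M * C ^ 3 * (1 - t)⁻¹ ^ 2) * t ^ (3 * n) := by
  have hsub := sphere_subset_annulus hs1
  have hdii := hdi.fun_inv fun z _ => hdi0 z
  have hdei := hde.fun_inv fun z _ => hde0 z
  have hS : DifferentiableOn ℂ (fun z => di z * de z) (annulus s) := hdi.fun_mul hde
  have hU : DifferentiableOn ℂ (fun z => 1 / (di z * de z)) (annulus s) :=
    (differentiableOn_const 1).fun_div hS fun z _ => mul_ne_zero (hdi0 z) (hde0 z)
  have hg : DifferentiableOn ℂ (fun z => Y z * (di z / de z)) (annulus s) :=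
    hY.fun_mul (hdi.fun_div hde fun z _ => hde0 z)
  have cY := hY.continuousOn.mono hsub
  have cdi := hdi.continuousOn.mono hsub
  have cde := hde.continuousOn.mono hsub
  have cdii := hdii.continuousOn.mono hsub
  have cdei := hdei.continuousOn.mono hsub
  have cS := hS.continuousOn.mono hsub
  have cU := hU.continuousOn.mono hsub
  have cg := hg.continuousOn.mono hsub
  -- `A` carries the nonpositive frequencies of `Y di / de`. By the gap on `[1, n]`, the rest starts
  -- at frequency `n + 1`, so after the shift `B` has only nonnegative ones.
  obtain ⟨A, cA, hA⟩ := exists_laurentCoeff_eq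
    ((summable_laurentCoeff hs hs1 hg).indicator {k : ℤ | k ≤ 0})
  have hA_pos : ∀ k > 0, laurentCoeff A k = 0 := fun k hk => by
    rw [hA, indicator_of_notMem (by simpa using hk)]
  have hA_nonpos : ∀ k ≤ 0, laurentCoeff A k = laurentCoeff (fun z => Y z * (di z / de z)) k :=
    fun k hk => by rw [hA, indicator_of_mem (by simpa using hk)]
  have hA_le : ∀ k, ‖laurentCoeff A k‖ ≤ M := fun k => by
    rcases le_or_gt k 0 with hk | hk
    · rw [hA_nonpos k hk]
      exact hM k
    · rw [hA_pos k hk, norm_zero]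
      exact (norm_nonneg _).trans (hM 0)
  set B : ℂ → ℂ := fun z => z ^ (-(n + 1 : ℤ)) * (Y z * (di z / de z) - A z) with hB
  have cB : ContinuousOn B (sphere 0 1) :=
    (continuousOn_zpow_unitSphere _).fun_mul (cg.fun_sub cA)
  have hB_neg : ∀ k < 0, laurentCoeff B k = 0 := fun k hk => by
    rw [hB, laurentCoeff_zpow_mul, laurentCoeff_sub cg cA]
    rcases le_or_gt (k - -(n + 1 : ℤ)) 0 with h | h
    · rw [hA_nonpos _ h, sub_self]
    · rw [hA_pos _ h, hgap _ (by omega) (by omega), sub_zero]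
  have cq : ContinuousOn (fun z => de z * A z) (sphere 0 1) := cde.fun_mul cA
  have cp : ContinuousOn (fun z => (di z)⁻¹ * B z) (sphere 0 1) := cdii.fun_mul cB
  have hsde := summable_laurentCoeff hs hs1 hde
  have hq_le : ∀ k, ‖laurentCoeff (fun z => de z * A z) k‖ ≤ (∑' k, ‖laurentCoeff de k‖) * M :=
    fun k => (hasSum_laurentCoeff_mul cde cA hsde k).norm_le_of_bounded
      (hsde.norm.hasSum.mul_right M) fun l => by
        rw [norm_mul]
        exact mul_le_mul_of_nonneg_left (hA_le _) (norm_nonneg _)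
  have hzz : ∀ z ∈ sphere (0 : ℂ) 1, z ^ (n + 1 : ℤ) * z ^ (-(n + 1 : ℤ)) = 1 := fun z hz => by
    rw [← zpow_add₀ (ne_zero_of_mem_unitSphere hz), add_neg_cancel, zpow_zero]
  -- The splitting `Y di / de = A + z ^ (n + 1) B` multiplied by `de`; `eq2` is the same identity
  -- divided by `di`.
  have eq1 : ∀ k, laurentCoeff (fun z => de z * A z) k +
      laurentCoeff (fun z => di z * de z * ((di z)⁻¹ * B z)) (k - (n + 1)) =
        laurentCoeff (fun z => di z * Y z) k := by
    intro k
    rw [← laurentCoeff_zpow_mul (n + 1), ← laurentCoeff_add cq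
      ((continuousOn_zpow_unitSphere _).fun_mul (cS.fun_mul cp))]
    refine laurentCoeff_congr (fun z hz => ?_) k
    have h1 := hdi0 z
    have h2 := hde0 z
    have h3 : z ^ (n + 1 : ℤ) * (di z * de z * ((di z)⁻¹ * B z)) =
        de z * (Y z * (di z / de z) - A z) := by
      calc _ = (z ^ (n + 1 : ℤ) * z ^ (-(n + 1 : ℤ))) * (di z * (di z)⁻¹) *
            (de z * (Y z * (di z / de z) - A z)) := by rw [hB]; ring
        _ = _ := by rw [hzz z hz, mul_inv_cancel₀ h1, one_mul, one_mul]
    rw [h3]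
    field_simp
    ring
  have eq2 : ∀ k, laurentCoeff (fun z => 1 / (di z * de z) * (de z * A z)) k +
      laurentCoeff (fun z => (di z)⁻¹ * B z) (k - (n + 1)) =
        laurentCoeff (fun z => (de z)⁻¹ * Y z) k := by
    intro k
    rw [← laurentCoeff_zpow_mul (n + 1), ← laurentCoeff_add (cU.fun_mul cq)
      ((continuousOn_zpow_unitSphere _).fun_mul cp)]
    refine laurentCoeff_congr (fun z hz => ?_) k
    have h1 := hdi0 z
    have h2 := hde0 z
    have h3 : z ^ (n + 1 : ℤ) * ((di z)⁻¹ * B z) = (di z)⁻¹ * (Y z * (di z / de z) - A z) := by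
      calc _ = (z ^ (n + 1 : ℤ) * z ^ (-(n + 1 : ℤ))) *
            ((di z)⁻¹ * (Y z * (di z / de z) - A z)) := by rw [hB]; ring
        _ = _ := by rw [hzz z hz, one_mul]
    rw [h3]
    field_simp
    ring
  obtain ⟨hl, hl0⟩ := laurentCoeff_mul_of_nonneg_support cdi cY
    (summable_laurentCoeff hs hs1 hdi) di_supp Y_neg
  -- The shift by `z ^ (-n)` moves the support of `Y` into `k ≤ 0`, so the top coefficient of `Y /
  -- de` becomes a zeroth coefficient.
  obtain ⟨hr, hr0⟩ := laurentCoeff_mul_of_nonpos_support (g := fun z => z ^ (-n : ℤ) * Y z) cdei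
    ((continuousOn_zpow_unitSphere _).fun_mul cY) (summable_laurentCoeff hs hs1 hdei) de_inv_supp
    (fun k hk => by rw [laurentCoeff_zpow_mul]; exact Y_gt _ (by omega))
  have hshift : ∀ k, laurentCoeff (fun z => (de z)⁻¹ * (z ^ (-n : ℤ) * Y z)) k =
      laurentCoeff (fun z => (de z)⁻¹ * Y z) (k + n) := fun k => by
    simp only [mul_left_comm _ (_ ^ _)]
    rw [laurentCoeff_zpow_mul, sub_neg_eq_add]
  rw [hshift, laurentCoeff_zpow_mul, zero_add, sub_neg_eq_add, zero_add] at hr0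
  refine norm_sub_le_of_coupled hC ht0 ht1 hu hv
    (hasSum_laurentCoeff_mul cU cq (summable_laurentCoeff hs hs1 hU))
    (hasSum_laurentCoeff_mul cS cp (summable_laurentCoeff hs hs1 hS))
    (laurentCoeff_mul_of_nonneg_support cdii cB (summable_laurentCoeff hs hs1 hdii)
      di_inv_supp hB_neg).1
    (laurentCoeff_mul_of_nonpos_support cde cA hsde de_supp hA_pos).1
    hq_le (fun k hk => by rw [eq1, hl k hk]) (by rw [eq1, hl0]) (fun k hk => ?_)
    (by rw [eq2, hr0])
  rw [eq2]
  have h := hr (k - n) (by omega)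
  rwa [hshift, sub_add_cancel] at h

/-! ### Orthogonal polynomials on the unit circle -/

theorem laurentCoeff_eval (P : ℂ[X]) (k : ℤ) :
    laurentCoeff (fun z => P.eval z) k =
      ∑ i : Fin (P.natDegree + 1), P.coeff i * if k = (i : ℕ) then 1 else 0 := by
  have h := hasSum_laurentCoeff (F := fun (i : Fin (P.natDegree + 1)) z =>
    P.coeff i * z ^ ((i : ℕ) : ℤ)) (f := fun z => P.eval z) (u := fun i => ‖P.coeff i‖)
    (hasSum_fintype _).summable
    (fun i => continuousOn_const.mul (continuousOn_zpow_unitSphere _))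
    (fun i z hz => by rw [norm_mul, norm_zpow_of_mem_unitSphere hz, mul_one])
    (fun z _ => by
      rw [P.eval_eq_sum_range, ← Fin.sum_univ_eq_sum_range fun i => P.coeff i * z ^ i]
      simpa only [zpow_natCast] using hasSum_fintype _) k
  simp only [laurentCoeff_const_mul, laurentCoeff_zpow] at h
  exact h.unique (hasSum_fintype _)

theorem laurentCoeff_eval_natCast (P : ℂ[X]) {j : ℕ} (hj : j ≤ P.natDegree) :
    laurentCoeff (fun z => P.eval z) j = P.coeff j := by
  rw [laurentCoeff_eval, Finset.sum_eq_single (⟨j, Nat.lt_succ_of_le hj⟩ : Fin _)]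
  · simp
  · intro i _ hi
    rw [if_neg, mul_zero]
    intro h
    exact hi (Fin.ext (by exact_mod_cast h.symm))
  · simp

theorem laurentCoeff_eval_eq_zero (P : ℂ[X]) {k : ℤ} (hk : k < 0 ∨ (P.natDegree : ℤ) < k) :
    laurentCoeff (fun z => P.eval z) k = 0 := by
  rw [laurentCoeff_eval]
  refine Finset.sum_eq_zero fun i _ => ?_
  rw [if_neg, mul_zero]
  have := i.isLt
  omega

theorem weightInner_eq_laurentCoeff {w : Circle → ℝ} {wt : ℂ → ℂ}
    (hwt : ∀ z : Circle, wt z = w z) (P Q : ℂ[X]) :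
    weightInner w P Q =
      2 * π * laurentCoeff (fun z => P.eval z * conj (Q.eval z) * wt z) 0 := by
  have h : ∀ θ : ℝ, circleMap 0 1 θ = (Circle.exp θ : ℂ) := fun θ => by simp [circleMap]
  rw [weightInner, laurentCoeff_eq_intervalIntegral, ← mul_assoc, mul_inv_cancel₀, one_mul]
  · simp only [h, hwt, neg_zero, zpow_zero, mul_one]
  · exact_mod_cast Real.two_pi_pos.ne'

theorem weightInner_sub_left {w : Circle → ℝ} (hw : Continuous w) (P P' Q : ℂ[X]) :
    weightInner w (P - P') Q = weightInner w P Q - weightInner w P' Q := by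
  simp only [weightInner, eval_sub, sub_mul]
  exact intervalIntegral.integral_sub
    ((weightInner_integrand_continuous hw P Q).intervalIntegrable _ _)
    ((weightInner_integrand_continuous hw P' Q).intervalIntegrable _ _)

theorem weightInner_sum_C_mul_left {w : Circle → ℝ} (hw : Continuous w) {ι : Type*}
    (s : Finset ι) (c : ι → ℂ) (P : ι → ℂ[X]) (Q : ℂ[X]) :
    weightInner w (∑ i ∈ s, C (c i) * P i) Q = ∑ i ∈ s, c i * weightInner w (P i) Q := by
  simp only [weightInner, eval_finsetSum, eval_mul, eval_C, Finset.sum_mul]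
  rw [intervalIntegral.integral_finsetSum fun i _ => ?_]
  · refine Finset.sum_congr rfl fun i _ => ?_
    rw [← intervalIntegral.integral_const_mul]
    simp only [mul_assoc]
  · have h := (weightInner_integrand_continuous hw (C (c i) * P i) Q).intervalIntegrable
      (μ := MeasureTheory.volume) 0 (2 * π)
    simpa only [eval_mul, eval_C] using h

/-- By Gram–Schmidt, `X ^ j` differs from the `j`-th polynomial by terms of index below `j ≤ n`, all
orthogonal to the `n`-th. -/
theorem weightInner_X_pow_monicOPUC {w : Circle → ℝ} (hw : Continuous w) (hpos : ∀ z, 0 < w z)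
    {j n : ℕ} (hj : j ≤ n) :
    weightInner w (X ^ j) (monicOPUC w n) = weightInner w (monicOPUC w j) (monicOPUC w n) := by
  conv_rhs => rw [monicOPUC_eq w j, weightInner_sub_left hw, weightInner_sum_C_mul_left hw]
  rw [Finset.sum_eq_zero, sub_zero]
  intro k _
  have hk := k.isLt
  have hkn : n ≠ k := by omega
  rw [monicOPUC_orthogonal hw hpos hkn, mul_zero]

/-- With `P = Φ_n`, `∫ |P|² w = ⟨z^n, P⟩ ≤ ∫ |P| w`, while `2 |P| ≤ |P|² + 1` pointwise. The
resulting bound does not depend on `n` and controls every Laurent coefficient of `Y w`. -/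
theorem integral_norm_monicOPUC_mul_le {w : Circle → ℝ} (hw : Continuous w)
    (hpos : ∀ z, 0 < w z) (n : ℕ) :
    ∫ θ in (0 : ℝ)..2 * π, ‖(monicOPUC w n).eval (Circle.exp θ : ℂ)‖ * w (Circle.exp θ) ≤
      ∫ θ in (0 : ℝ)..2 * π, w (Circle.exp θ) := by
  set P := monicOPUC w n
  have c1 : Continuous fun θ : ℝ => ‖P.eval (Circle.exp θ : ℂ)‖ * w (Circle.exp θ) := by fun_prop
  have c2 : Continuous fun θ : ℝ => ‖P.eval (Circle.exp θ : ℂ)‖ ^ 2 * w (Circle.exp θ) := by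
    fun_prop
  have c3 : Continuous fun θ : ℝ => w (Circle.exp θ) := by fun_prop
  have hpi := Real.two_pi_pos.le
  have h1 : ∫ θ in (0 : ℝ)..2 * π, ‖P.eval (Circle.exp θ : ℂ)‖ ^ 2 * w (Circle.exp θ) ≤
      ∫ θ in (0 : ℝ)..2 * π, ‖P.eval (Circle.exp θ : ℂ)‖ * w (Circle.exp θ) := by
    have h : weightInner w P P =
        ((∫ θ in (0 : ℝ)..2 * π, ‖P.eval (Circle.exp θ : ℂ)‖ ^ 2 * w (Circle.exp θ) : ℝ) : ℂ) := by
      rw [weightInner, ← intervalIntegral.integral_ofReal]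
      congr 1
      ext θ
      rw [Complex.mul_conj, Complex.normSq_eq_norm_sq]
      push_cast
      rfl
    have h2 : ‖weightInner w (X ^ n) P‖ ≤
        ∫ θ in (0 : ℝ)..2 * π, ‖P.eval (Circle.exp θ : ℂ)‖ * w (Circle.exp θ) := by
      refine (intervalIntegral.norm_integral_le_integral_norm hpi).trans_eq ?_
      congr 1
      ext θ
      simp [abs_of_pos (hpos _)]
    rw [weightInner_X_pow_monicOPUC hw hpos le_rfl, h, Complex.norm_real] at h2
    exact (le_abs_self _).trans h2
  have h3 : 2 * ∫ θ in (0 : ℝ)..2 * π, ‖P.eval (Circle.exp θ : ℂ)‖ * w (Circle.exp θ) ≤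
      (∫ θ in (0 : ℝ)..2 * π, ‖P.eval (Circle.exp θ : ℂ)‖ ^ 2 * w (Circle.exp θ)) +
        ∫ θ in (0 : ℝ)..2 * π, w (Circle.exp θ) := by
    rw [← intervalIntegral.integral_const_mul, ← intervalIntegral.integral_add
      (c2.intervalIntegrable _ _) (c3.intervalIntegrable _ _)]
    refine intervalIntegral.integral_mono_on hpi ((continuous_const.mul c1).intervalIntegrable _ _)
      ((c2.add c3).intervalIntegrable _ _) fun θ _ => ?_
    nlinarith [mul_nonneg (sq_nonneg (‖P.eval (Circle.exp θ : ℂ)‖ - 1)) (hpos (Circle.exp θ)).le]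
  linarith

/-- The reversed polynomial `z ^ n * conj (P (1 / conj z))`. -/
noncomputable def reversedEval (n : ℕ) (P : ℂ[X]) (z : ℂ) : ℂ :=
  z ^ (n : ℤ) * (P.map (starRingEnd ℂ)).eval z⁻¹

theorem reversedEval_eq_of_mem_sphere (n : ℕ) (P : ℂ[X]) {z : ℂ} (hz : z ∈ sphere (0 : ℂ) 1) :
    reversedEval n P z = z ^ (n : ℤ) * conj (P.eval z) := by
  rw [reversedEval, Complex.inv_eq_conj (mem_sphere_zero_iff_norm.mp hz), eval_map,
    eval₂_at_apply]

theorem differentiableOn_reversedEval (n : ℕ) (P : ℂ[X]) {s : ℝ} (hs : 0 ≤ s) :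
    DifferentiableOn ℂ (reversedEval n P) (annulus s) := fun z hz => by
  have h0 : z ≠ 0 := norm_pos_iff.mp (hs.trans_lt hz.1)
  exact (((differentiableAt_zpow (m := (n : ℤ))).mpr (Or.inl h0)).fun_mul
    ((Polynomial.differentiable _).differentiableAt.comp z
      (differentiableAt_inv h0))).differentiableWithinAt

theorem laurentCoeff_reversedEval (n : ℕ) (P : ℂ[X]) (k : ℤ) :
    laurentCoeff (reversedEval n P) k = conj (laurentCoeff (fun z => P.eval z) (n - k)) := by
  rw [laurentCoeff_congr (fun z hz => reversedEval_eq_of_mem_sphere n P hz),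
    laurentCoeff_zpow_mul, laurentCoeff_conj, neg_sub]

/-! ### Analytic weights -/

theorem IsAnalyticWeight.continuous {w : Circle → ℝ} (h : IsAnalyticWeight w) : Continuous w := by
  obtain ⟨W, hW, hWw⟩ := h
  have h1 : Continuous fun z : Circle => W z :=
    continuous_iff_continuousAt.mpr fun z =>
      ContinuousAt.comp (hW z (by
        rw [mem_sphere_zero_iff_norm, Circle.norm_coe])).continuousAt
        (continuous_subtype_val (p := fun z => z ∈ Submonoid.unitSphere ℂ)).continuousAt
  have h2 : w = fun z : Circle => (W z).re := by
    ext z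
    rw [hWw, ofReal_re]
  rw [h2]
  exact continuous_re.comp h1

theorem exists_annulus_subset {U : Set ℂ} (hU : IsOpen U) (h : sphere (0 : ℂ) 1 ⊆ U) :
    ∃ s : ℝ, 0 < s ∧ s < 1 ∧ annulus s ⊆ U := by
  obtain ⟨δ, hδ, hsub⟩ := (isCompact_sphere (0 : ℂ) 1).exists_thickening_subset_open hU h
  have h1 : 0 < 1 + δ := by linarith
  refine ⟨(1 + δ)⁻¹, by positivity, inv_lt_one_of_one_lt₀ (by linarith), fun z hz => hsub ?_⟩
  obtain ⟨hl, hr⟩ := hz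
  have hz0 : 0 < ‖z‖ := (by positivity : 0 < (1 + δ)⁻¹).trans hl
  have hr' : ‖z‖ < 1 + δ := by
    rwa [inv_mul_lt_iff₀ h1, mul_one] at hr
  have hl' : 1 < (1 + δ) * ‖z‖ := by
    rwa [inv_lt_iff_one_lt_mul₀' h1] at hl
  rw [mem_thickening_iff]
  refine ⟨z / ‖z‖, by simp [hz0.ne'], ?_⟩
  have hzc : (‖z‖ : ℂ) ≠ 0 := by exact_mod_cast hz0.ne'
  have h2 : z - z / ‖z‖ = (z / ‖z‖) * ((‖z‖ - 1 : ℝ) : ℂ) := by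
    push_cast
    field_simp
  rw [dist_eq_norm, h2, norm_mul, norm_div, Complex.norm_real, Complex.norm_real, norm_norm,
    div_self hz0.ne', one_mul, Real.norm_eq_abs, abs_lt]
  constructor
  · nlinarith
  · linarith

theorem IsAnalyticWeight.exists_annulus {w : Circle → ℝ} (h : IsAnalyticWeight w)
    (hpos : ∀ z, 0 < w z) :
    ∃ s : ℝ, 0 < s ∧ s < 1 ∧ ∃ W : ℂ → ℂ, DifferentiableOn ℂ W (annulus s) ∧
      (∀ z ∈ annulus s, W z ≠ 0) ∧ ∀ z : Circle, W z = w z := by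
  obtain ⟨W, hW, hWw⟩ := h
  have hd : DifferentiableOn ℂ W {z | AnalyticAt ℂ W z} := fun z hz =>
    (AnalyticAt.differentiableAt hz).differentiableWithinAt
  have hopen : IsOpen ({z | AnalyticAt ℂ W z} ∩ W ⁻¹' {0}ᶜ) :=
    hd.continuousOn.isOpen_inter_preimage (isOpen_analyticAt ℂ W) isOpen_compl_singleton
  obtain ⟨s, hs0, hs1, hsub⟩ := exists_annulus_subset hopen fun z hz => ⟨hW z hz, by
    obtain ⟨c, rfl⟩ := exists_circle_coe_eq hz
    simpa [hWw] using (hpos c).ne'⟩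
  exact ⟨s, hs0, hs1, W, hd.mono fun z hz => (hsub hz).1, fun z hz => (hsub hz).2, hWw⟩

/-! ### Asymptotics of the Verblunsky coefficients -/

theorem exists_norm_verblunsky_add_le {w : Circle → ℝ} (hpos : ∀ z, 0 < w z)
    (han : IsAnalyticWeight w) {r : ℝ} (hr : criticalRadius w < r) (hr1 : r < 1) :
    ∃ K : ℝ, ∀ n : ℕ,
      ‖verblunsky w n - (-laurentCoeff (fun t => 1 / scattering w t) (n + 1))‖
        ≤ K * r ^ (3 * n) := by
  have hw := han.continuous
  obtain ⟨s, hs, hs1, W, hW, hW0, hWw⟩ := han.exists_annulus hpos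
  -- Two annuli are in play: `w` is zero-free and holomorphic in `annulus s`, with `s` possibly
  -- close to `1`, while `1/w` continues to `annulus r'` with `r' < r`.
  obtain ⟨r', ⟨hr'0, hr'1, V, hV, hVw⟩, hrr⟩ := exists_lt_of_csInf_lt
    (s := {r : ℝ | 0 < r ∧ r < 1 ∧ ∃ V : ℂ → ℂ,
      DifferentiableOn ℂ V (annulus r) ∧ ∀ z : Circle, V z = 1 / (w z : ℂ)})
    ⟨s, hs, hs1, fun z => 1 / W z, (differentiableOn_const 1).div hW hW0,
      fun z => by simp only [hWw]⟩ hr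
  have hr0 : 0 < r := hr'0.trans hrr
  obtain ⟨hp, hm, hpd, hmd, h0, -, -, hlog, hconj, hb⟩ :=
    szego_continuation hpos hs.le hs1 hW hW0 hWw
  set di : ℂ → ℂ := fun z => exp (hp z) with hdi_def
  set de : ℂ → ℂ := fun z => exp (-hm z⁻¹) with hde_def
  have hmi := differentiableOn_comp_inv hs.le hmd
  have hcb : closedBall (0 : ℂ) 1 ⊆ {z | s * ‖z‖ < 1} := fun z hz => by
    have := mem_closedBall_zero_iff.mp hz
    exact (mul_le_of_le_one_right hs.le this).trans_lt hs1
  have hopen := isOpen_mul_norm_lt_one s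
  have hdi : DifferentiableOn ℂ di (annulus s) := hpd.cexp.mono fun z hz => hz.2
  have hde : DifferentiableOn ℂ de (annulus s) := hmi.neg.cexp.mono fun z hz => hz.1
  have hdi' := laurentCoeff_of_differentiableOn_closedBall hopen hcb hpd.cexp
  have hdii := laurentCoeff_of_differentiableOn_closedBall hopen hcb hpd.neg.cexp
  have hde' := laurentCoeff_of_differentiableOn_closedBall hopen hcb hmd.neg.cexp
  have hdei := laurentCoeff_of_differentiableOn_closedBall hopen hcb hmd.cexp
  have hdi_inv : (fun z => (di z)⁻¹) = fun z => exp (-hp z) := by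
    ext z
    rw [exp_neg]
  have hde_inv : (fun z => (de z)⁻¹) = fun z => exp (hm z⁻¹) := by
    ext z
    simp only [hde_def]
    rw [exp_neg, inv_inv]
  have de_inv_coeff : ∀ k, laurentCoeff (fun z => (de z)⁻¹) k =
      laurentCoeff (fun z => exp (hm z)) (-k) := fun k => by
    rw [hde_inv, laurentCoeff_comp_inv fun z => exp (hm z)]
  have de_coeff : ∀ k, laurentCoeff de k = laurentCoeff (fun z => exp (-hm z)) (-k) := fun k =>
    laurentCoeff_comp_inv (fun z => exp (-hm z)) k
  have hwt : ∀ z : Circle, di z / de z = w z := fun z => by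
    rw [hdi_def, hde_def, ← exp_sub, sub_neg_eq_add, hlog, ← ofReal_exp, Real.exp_log (hpos z)]
  -- decay of the coefficients of `1 / 𝒮`
  obtain ⟨C, hC0, hC⟩ : ∃ C : ℝ, 0 ≤ C ∧
      ∀ k : ℤ, ‖laurentCoeff (fun z => 1 / (di z * de z)) k‖ ≤ C * r⁻¹ ^ (-k) := by
    -- On the circle `1 / (di de) = (de / di) / de² = V / de²`. As `1 / de` is holomorphic in `s <
    -- ‖z‖`, this continues outwards past radius `1 / r`, even where `di` is not known to continue.
    have hd : DifferentiableOn ℂ (fun z => V z * exp (hm z⁻¹) ^ 2)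
        ({z | s < ‖z‖} ∩ annulus r') :=
      (hV.mono inter_subset_right).fun_mul ((hmi.cexp.mono inter_subset_left).fun_pow 2)
    have hri : 1 < r⁻¹ := (one_lt_inv₀ hr0).mpr hr1
    have h := exists_norm_laurentCoeff_le ((isOpen_lt_norm s).inter (isOpen_annulus r')) hd
      (inv_pos.mpr hr0) fun z h1 h2 => by
        rw [min_eq_left hri.le] at h1
        rw [max_eq_right hri.le] at h2
        refine ⟨hs1.trans_le h1, hr'1.trans_le h1, ?_⟩
        calc r' * ‖z‖ ≤ r' * r⁻¹ := by gcongr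
          _ < r * r⁻¹ := by gcongr
          _ = 1 := mul_inv_cancel₀ hr0.ne'
    have hcongr : EqOn (fun z => 1 / (di z * de z)) (fun z => V z * exp (hm z⁻¹) ^ 2)
        (sphere 0 1) := fun z hz => by
      obtain ⟨c, rfl⟩ := exists_circle_coe_eq hz
      have h1 : exp (hm (c : ℂ)⁻¹) = (de c)⁻¹ := (congrFun hde_inv c).symm
      have h2 : di c ≠ 0 := exp_ne_zero _
      have h3 : de c ≠ 0 := exp_ne_zero _
      simp only
      rw [hVw, h1, ← hwt]
      field_simp
    simpa only [laurentCoeff_congr hcongr] using h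
  have hu : ∀ k : ℕ, ‖laurentCoeff (fun z => 1 / (di z * de z)) k‖ ≤ C * r ^ k := fun k => by
    simpa only [inv_zpow', neg_neg, zpow_natCast] using hC k
  have hv : ∀ k : ℕ, ‖laurentCoeff (fun z => di z * de z) (-k)‖ ≤ C * r ^ k := fun k => by
    -- On the circle `di de = exp (h₊ - conj h₊)` is unimodular, so the decay of `1/𝒮` at positive
    -- indices is that of `𝒮` at negative ones.
    have h1 : EqOn (fun z => di z * de z) (fun z => conj (1 / (di z * de z))) (sphere 0 1) :=
      fun z hz => by
        have h2 := hconj z hz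
        simp only [hdi_def, hde_def]
        rw [← exp_add, one_div, ← exp_neg, ← exp_conj, h2]
        simp
    rw [laurentCoeff_congr h1, laurentCoeff_conj, neg_neg, RCLike.norm_conj]
    exact hu k
  set M : ℝ := (2 * π)⁻¹ * ∫ θ in (0 : ℝ)..2 * π, w (Circle.exp θ) with hM_def
  -- Both are exponentials of half the mean of `log w`, by `hp 0 = hm 0`; this common factor is
  -- divided out at the end.
  have hcoeff0 : laurentCoeff (fun z => (de z)⁻¹) 0 = laurentCoeff di 0 := by
    rw [de_inv_coeff, neg_zero, hdei.2, hdi'.2, h0]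
  have hdi00 : laurentCoeff di 0 ≠ 0 := by
    rw [hdi'.2]
    exact exp_ne_zero _
  set L : ℝ := (∑' k, ‖laurentCoeff de k‖) * M * C ^ 3 * (1 - r)⁻¹ ^ 3 +
        (∑' k, ‖laurentCoeff de k‖) * M * C ^ 3 * (1 - r)⁻¹ ^ 2 with hL
  refine ⟨‖laurentCoeff di 0‖⁻¹ * L, fun n => ?_⟩
  set P := monicOPUC w (n + 1)
  obtain ⟨hmonic, hdeg⟩ := monicOPUC_monic_natDegree w (n + 1)
  have hg : EqOn (fun z => reversedEval (n + 1) P z * (di z / de z))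
      (fun z => z ^ ((n + 1 : ℕ) : ℤ) * (conj (P.eval z) * (di z / de z))) (sphere 0 1) :=
    fun z hz => by
      simp only [reversedEval_eq_of_mem_sphere _ _ hz, mul_assoc]
  have key := norm_top_laurentCoeff_sub_le (Y := reversedEval (n + 1) P) (n := n + 1) (M := M)
    hs.le hs1 (differentiableOn_reversedEval _ _ hs.le) hdi hde (fun z => exp_ne_zero _)
    (fun z => exp_ne_zero _) hdi'.1 (by rw [hdi_inv]; exact hdii.1)
    (fun k hk => by rw [de_coeff]; exact hde'.1 _ (by omega))
    (fun k hk => by rw [de_inv_coeff]; exact hdei.1 _ (by omega))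
    (fun k hk => by
      rw [laurentCoeff_reversedEval, laurentCoeff_eval_eq_zero _ (Or.inr (by rw [hdeg]; omega)),
        map_zero])
    (fun k hk => by
      rw [laurentCoeff_reversedEval, laurentCoeff_eval_eq_zero _ (Or.inl (by omega)), map_zero])
    (fun k hk1 hk2 => by
      -- The `k`-th coefficient of `Y w` is, up to the factor `2π`, the pairing of `X ^ (n + 1 - k)`
      -- with `P`, and `0 ≤ n + 1 - k ≤ n`.
      obtain ⟨j, hj⟩ : ∃ j : ℕ, ((n + 1 : ℕ) : ℤ) - k = j := ⟨(n + 1 - k).toNat, by omega⟩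
      have h1 := weightInner_X_pow_monicOPUC hw hpos (j := j) (n := n + 1) (by omega)
      rw [monicOPUC_orthogonal hw hpos (by omega),
        weightInner_eq_laurentCoeff (wt := fun z => di z / de z) hwt] at h1
      have h2 := (mul_eq_zero.mp h1).resolve_left (by exact_mod_cast Real.two_pi_pos.ne')
      simp only [eval_pow, eval_X, mul_assoc, ← zpow_natCast, laurentCoeff_zpow_mul] at h2
      rw [laurentCoeff_congr hg, laurentCoeff_zpow_mul, ← h2]
      congr 1
      omega)
    hC0 hr0.le hr1
    (fun k => by
      have h1 : ∀ θ : ℝ, circleMap 0 1 θ = (Circle.exp θ : ℂ) := fun θ => by simp [circleMap]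
      rw [laurentCoeff_congr hg, laurentCoeff_zpow_mul, laurentCoeff_eq_intervalIntegral, norm_mul,
        hM_def]
      have h2 : ‖(2 * π : ℂ)⁻¹‖ = (2 * π)⁻¹ := by
        simp [abs_of_pos Real.pi_pos]
      rw [h2]
      refine mul_le_mul_of_nonneg_left ?_ (by positivity)
      refine ((intervalIntegral.norm_integral_le_integral_norm Real.two_pi_pos.le).trans_eq
        ?_).trans (integral_norm_monicOPUC_mul_le hw hpos (n + 1))
      congr 1
      ext θ
      rw [norm_mul, norm_zpow_of_mem_unitSphere (circleMap_zero_one_mem θ), h1, hwt, norm_mul]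
      simp [abs_of_pos (hpos _), P])
    hu hv
  have hY0 : laurentCoeff (reversedEval (n + 1) P) 0 = 1 := by
    rw [laurentCoeff_reversedEval, sub_zero, laurentCoeff_eval_natCast _ hdeg.ge]
    have h1 : P.coeff (n + 1) = 1 := by
      rw [← hdeg]
      exact hmonic
    rw [h1, map_one]
  have hYn : laurentCoeff (reversedEval (n + 1) P) ((n + 1 : ℕ) : ℤ) = -verblunsky w n := by
    have h1 := laurentCoeff_eval_natCast P (Nat.zero_le _)
    rw [Nat.cast_zero] at h1
    rw [laurentCoeff_reversedEval, sub_self, h1, verblunsky, neg_neg, coeff_zero_eq_eval_zero]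
  have hscat : laurentCoeff (fun t => 1 / scattering w t) (n + 1) =
      laurentCoeff (fun z => 1 / (di z * de z)) ((n + 1 : ℕ) : ℤ) := by
    rw [Nat.cast_add, Nat.cast_one]
    refine laurentCoeff_congr (fun t ht => ?_) _
    have h1 := hb t (mem_sphere_zero_iff_norm.mp ht)
    simp only [scattering, ← h1.1, ← h1.2, hdi_def, hde_def]
  rw [hY0, hYn, hcoeff0, mul_one, ← mul_sub, norm_mul, ← hscat] at key
  have hpos0 : 0 < ‖laurentCoeff di 0‖ := norm_pos_iff.mpr hdi00
  -- The sign of `L` is read off from the fact that it bounds a norm; it is needed to weaken `r ^ (3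
  -- * (n + 1))` to `r ^ (3 * n)`.
  have hL0 : 0 ≤ L * r ^ (3 * (n + 1)) := le_trans (by positivity) key
  have hL1 : 0 ≤ L := nonneg_of_mul_nonneg_left hL0 (by positivity)
  rw [← norm_neg, neg_sub, neg_sub_left, mul_assoc, le_inv_mul_iff₀ hpos0]
  have h2 : ‖-(verblunsky w n + laurentCoeff (fun t => 1 / scattering w t) (n + 1))‖ =
      ‖-verblunsky w n - laurentCoeff (fun t => 1 / scattering w t) (n + 1)‖ := by
    congr 1
    ring
  rw [h2]
  refine key.trans (mul_le_mul_of_nonneg_left ?_ hL1)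
  exact pow_le_pow_of_le_one hr0.le hr1.le (by omega)

theorem mainTheorem4 (w : Circle → ℝ) (hpos : ∀ z, 0 < w z) (han : IsAnalyticWeight w) :
    -- continuation of `D_i`, `D_e` across the circle and the Laurent expansion of `1/𝒮`
    (∀ s : ℝ, 0 ≤ s → s < 1 →
      (∃ W : ℂ → ℂ, DifferentiableOn ℂ W (annulus s) ∧ (∀ z ∈ annulus s, W z ≠ 0) ∧
        ∀ z : Circle, W z = w z) →
      ∃ Di De : ℂ → ℂ,
        DifferentiableOn ℂ Di {z | s * ‖z‖ < 1} ∧ (∀ z : ℂ, ‖z‖ < 1 → Di z = szegoD w z) ∧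
        DifferentiableOn ℂ De {z | s < ‖z‖} ∧ (∀ z : ℂ, 1 < ‖z‖ → De z = szegoD w z) ∧
        (∀ z : ℂ, ‖z‖ = 1 → Di z = szegoInt w z ∧ De z = szegoExt w z) ∧
        ∀ z ∈ annulus s, Di z * De z ≠ 0 ∧
          HasSum (fun k : ℤ => laurentCoeff (fun t => 1 / scattering w t) k * z ^ k)
            (1 / (Di z * De z))) ∧
    -- the asymptotic formula for the Verblunsky coefficients
    ∀ r : ℝ, criticalRadius w < r → r < 1 →
      ∃ K : ℝ, ∀ n : ℕ,
        ‖verblunsky w n - (-laurentCoeff (fun t => 1 / scattering w t) (n + 1))‖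
          ≤ K * r ^ (3 * n) := by
  exact ⟨fun s hs hs1 h => exists_szego_continuation_hasSum hpos hs hs1 h,
    fun r hr hr1 => exists_norm_verblunsky_add_le hpos han hr hr1⟩
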